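/- Let $R$ be a commutative differential $\mathbb Q$-algebra of "functions" with derivation $\partial=\partial_x$ and commuting derivations $\partial_{t_n}$ ($n$ odd, $\partial_{t_1}=\partial$). Let $k\ge 1$, $m\ge 0$, $M\ge 0$ and let $L=\partial+\sum_{i\ge1}u_{i+1}\partial^{-i}$ be the Lax operator of the $(k,m)$-constrained CKP hierarchy, that is, for all odd $n\ge 1$, $a=1,2$ and $1\le i\le m$, $$L^*=-L,\quad L_{t_n}=[(L^n)_{\ge0},L],\quad (L^k)_{<0}=\sum_{i=1}^m\bigl(q_{1,i}\partial^{-1}q_{2,i}-(-1)^kq_{2,i}\partial^{-1}q_{1,i}\bigr),\quad \partial_{t_n}q_{a,i}=(L^n)_{\ge0}(q_{a,i}).$$ Let $f_1,\dots,f_M$ be eigenfunctions, $\partial_{t_n}f_j=(L^n)_{\ge0}(f_j)$. *Potentials.* A squared eigenfunction potential $\Omega(f,g)$ is a function with $\Omega(f,g)_{t_n}=\mathrm{Res}_\partial(\partial^{-1}gL^nf\partial^{-1})$ for all odd $n$ (so $\Omega(f,g)_x=fg$); it plays the role of $\partial^{-1}(fg)$. Fix a symmetric choice $\Omega(\cdot,\cdot)$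 of potentials for the pairs $(f_i,f_j)$, $(q_{a,i},f_j)$, $(f_i,L^k(f_j))$, where $$L^k(f):=(L^k)_{\ge0}(f)+\sum_{i=1}^m\bigl(q_{1,i}\,\Omega(q_{2,i},f)-(-1)^kq_{2,i}\,\Omega(q_{1,i},f)\bigr).$$ The integration constants are chosen consistently, meaning $\partial^{-1}\bigl(f_i\,L^k(f_j)\bigr)=(\partial^{-1}f_iL^k)(f_j)$, i.e. for all $i,j$ $$\Omega(f_i,L^k(f_j))=\mathrm{Res}_\partial(\partial^{-1}f_iL^kf_j\partial^{-1})+\sum_{l=1}^m\bigl(\Omega(f_i,q_{1,l})\Omega(q_{2,l},f_j)-(-1)^k\Omega(f_i,q_{2,l})\Omega(q_{1,l},f_j)\bigr)+(-1)^k\Omega(L^k(f_i),f_j).$$ *Darboux operators.* Let $T_D[f]=f\partial f^{-1}$ and $T_I[g]=g^{-1}\partial^{-1}g$. Acting on eigenfunctions $\varphi$, adjoint eigenfunctions $\psi$ and their potentials, $T_D[f]$ maps $$\varphi\mapsto f(\varphi/f)_x,\qquad \psi\mapsto -f^{-1}\Omega(f,\psi),\qquad \Omega(\varphi,\psi)\mapsto\Omega(\varphi,\psi)-\varphi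 f^{-1}\Omega(f,\psi),$$ and $T_I[g]$ maps $$\varphi\mapsto g^{-1}\Omega(\varphi,g),\qquad \psi\mapsto -g(\psi/g)_x,\qquad \Omega(\varphi,\psi)\mapsto\Omega(\varphi,\psi)-\psi g^{-1}\Omega(\varphi,g).$$ (In the CKP case eigenfunctions are also adjoint eigenfunctions.) Put $$T^{[n,p]}(f_1,\dots,f_n;g_1,\dots,g_p)=T_I[g_p^{[n+p-1]}]\cdots T_I[g_1^{[n]}]\,T_D[f_n^{[n-1]}]\cdots T_D[f_2^{[1]}]\,T_D[f_1],$$ where $f_i^{[i-1]}$, $g_j^{[n+j-1]}$ are the images of $f_i$, $g_j$ under the preceding factors. Let $T=T^{\{M\}}=T^{[M,M]}(f_1,\dots,f_M;f_1,\dots,f_M)$ and let $T^{[M\setminus\{j\},M]}=T^{[M-1,M]}(f_1,\dots,\widehat{f_j},\dots,f_M;f_1,\dots,f_M)$. Assume that all functions inverted in the construction of $T$ and of the $T^{[M\setminus\{j\},M]}$ are invertible. Then each $T^{[M\setminus\{j\},M]}(f_j)$ is invertible, $T$ is invertible as a pseudo-differential operator, and $$\begin{aligned}\bigl(T L^kT^{-1}\bigr)_{<0}={}&\sum_{j=1}^{M}(TL^k)(f_j)\cdot\partial^{-1}\cdot\bigl(T^{[M\setminus\{j\},M]}(f_j)\bigr)^{-1}-(-1)^k\sum_{j=1}^M\bigl(T^{[M\setminus\{j\},M]}(f_j)\bigr)^{-1}\cdot\partial^{-1}\cdot(TL^k)(f_j)\\&+\sum_{i=1}^{m}\bigl(T(q_{1,i})\cdot\partial^{-1}\cdot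 T(q_{2,i})-(-1)^kT(q_{2,i})\cdot\partial^{-1}\cdot T(q_{1,i})\bigr),\end{aligned}$$ where $(TL^k)(f_j)=T(L^k(f_j))$. Thus the form of the constraint is preserved, with $m$ replaced by $m+M$. -/

import Mathlib

/-! ### Formal pseudo-differential operators

`R` is a commutative differential ring (Mathlib's `Differential R`); its elements play the role of
functions of `t = (t₁ = x, t₃, t₅, …)` and `Differential.deriv` is `∂ = ∂ₓ`. -/

/-- Coefficient sequences `(a_i)_{i ∈ ℤ}` with `a_i = 0` for all large `i`. -/
def PDO.coeffSeq (R : Type*) [CommRing R] : AddSubgroup (ℤ → R) where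
  carrier := {a | ∃ N : ℤ, ∀ n, N < n → a n = 0}
  zero_mem' := ⟨0, fun _ _ => rfl⟩
  add_mem' := by
    rintro a b ⟨N, hN⟩ ⟨K, hK⟩
    refine ⟨max N K, fun n hn => ?_⟩
    simp [hN n (lt_of_le_of_lt (le_max_left _ _) hn), hK n (lt_of_le_of_lt (le_max_right _ _) hn)]
  neg_mem' := by
    rintro a ⟨N, hN⟩
    exact ⟨N, fun n hn => by simp [hN n hn]⟩

/-- Formal pseudo-differential operators `∑_{i ≤ N} a_i ∂^i` over `R`. -/
def PDO (R : Type*) [CommRing R] : Type _ := PDO.coeffSeq R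

namespace PDO

section Additive

variable {R : Type*} [CommRing R]

instance : AddCommGroup (PDO R) := inferInstanceAs (AddCommGroup (PDO.coeffSeq R))

/-- The coefficient of `∂^n`. -/
def coeff (A : PDO R) (n : ℤ) : R := A.1 n

theorem exists_bound (A : PDO R) : ∃ N : ℤ, ∀ n, N < n → A.coeff n = 0 := A.2

/-- The operator `a ∂^i`. -/
def monomial (i : ℤ) (a : R) : PDO R :=
  ⟨fun n => if n = i then a else 0, i, fun _ hn => if_neg (ne_of_gt hn)⟩

/-- Multiplication by the function `a`, that is `a ∂^0`. -/
def C (a : R) : PDO R := monomial 0 a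

/-- The power `∂^i`, `i ∈ ℤ`. -/
def del (R : Type*) [CommRing R] (i : ℤ) : PDO R := monomial i 1

instance : One (PDO R) := ⟨C 1⟩

/-- The differential part `A_{≥0} = ∑_{i ≥ 0} a_i ∂^i`. -/
def nonneg (A : PDO R) : PDO R :=
  ⟨fun n => if 0 ≤ n then A.coeff n else 0, by
    obtain ⟨N, hN⟩ := A.exists_bound
    exact ⟨N, fun n hn => by simp [hN n hn]⟩⟩

/-- The integral part `A_{<0} = ∑_{i < 0} a_i ∂^i`. -/
def neg (A : PDO R) : PDO R :=
  ⟨fun n => if n < 0 then A.coeff n else 0, by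
    obtain ⟨N, hN⟩ := A.exists_bound
    exact ⟨N, fun n hn => by simp [hN n hn]⟩⟩

/-- `Res_∂ A`, the coefficient of `∂^{-1}`. -/
def res (A : PDO R) : R := A.coeff (-1)

/-- Apply a derivation of `R` to all coefficients (the time derivative `A_{t_n}`). -/
def mapDeriv (δ : Derivation ℤ R R) (A : PDO R) : PDO R :=
  ⟨fun n => δ (A.coeff n), by
    obtain ⟨N, hN⟩ := A.exists_bound
    exact ⟨N, fun n hn => by simp [hN n hn]⟩⟩

end Additive

section Multiplicative

variable {R : Type*} [CommRing R] [Differential R]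

/-- The product determined by `∂^i b = ∑_{l ≥ 0} (i choose l) b^{(l)} ∂^{i-l}` (`i ∈ ℤ`):
the coefficient of `∂^n` in `A B` is `∑_{i, l} (i choose l) a_i (b_{n-i+l})^{(l)}`, a sum with
finitely many nonzero terms. -/
noncomputable def mul (A B : PDO R) : PDO R :=
  ⟨fun n => ∑ᶠ p : ℤ × ℕ, (Ring.choose p.1 p.2 : ℤ) •
      (A.coeff p.1 * (Differential.deriv (R := R))^[p.2] (B.coeff (n - p.1 + p.2))), by
    obtain ⟨N, hN⟩ := A.exists_bound
    obtain ⟨K, hK⟩ := B.exists_bound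
    refine ⟨N + K, fun n hn => ?_⟩
    refine (finsum_congr fun p => ?_).trans finsum_zero
    by_cases h : N < p.1
    · simp [hN _ h]
    · rw [hK (n - p.1 + p.2) (by omega), iterate_map_zero]
      simp⟩

noncomputable instance : Mul (PDO R) := ⟨mul⟩

/-- Powers `A^k = A ⋯ A`. -/
noncomputable def npow (A : PDO R) : ℕ → PDO R
  | 0 => 1
  | k + 1 => npow A k * A

noncomputable instance : Pow (PDO R) ℕ := ⟨npow⟩

/-- The formal adjoint `(∑ a_i ∂^i)^* = ∑ (-1)^i ∂^i a_i`: the coefficient of `∂^n` is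
`∑_{l ≥ 0} (-1)^{n+l} (n+l choose l) (a_{n+l})^{(l)}`. -/
noncomputable def adjoint (A : PDO R) : PDO R :=
  ⟨fun n => ∑ᶠ l : ℕ, ((Int.negOnePow (n + l) : ℤ) * Ring.choose (n + l) l) •
      (Differential.deriv (R := R))^[l] (A.coeff (n + l)), by
    obtain ⟨N, hN⟩ := A.exists_bound
    refine ⟨N, fun n hn => ?_⟩
    refine (finsum_congr fun l => ?_).trans finsum_zero
    rw [hN (n + l) (by omega), iterate_map_zero, smul_zero]⟩

/-- The function `A_{≥0}(f) = ∑_{i ≥ 0} a_i f^{(i)}`. -/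
noncomputable def applyNonneg (A : PDO R) (f : R) : R :=
  ∑ᶠ i : ℕ, A.coeff i * (Differential.deriv (R := R))^[i] f

end Multiplicative

end PDO

/-! ### The constrained CKP hierarchy -/

/-- The commuting time derivations `∂_{t_n}`; only odd `n` are used, and `∂_{t_1} = ∂_x`. -/
structure OddTimes (R : Type*) [CommRing R] [Differential R] where
  d : ℕ → Derivation ℤ R R
  d_one : d 1 = Differential.deriv
  d_comm : ∀ n p : ℕ, Odd n → Odd p → ∀ a : R, d n (d p a) = d p (d n a)

section CKP

variable {R : Type*} [CommRing R] [Differential R]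

open PDO

/-- `∑_i (a_i ∂^{-1} b_i - (-1)^k b_i ∂^{-1} a_i)`. -/
noncomputable def constraintForm (k : ℕ) {m : ℕ} (a b : Fin m → R) : PDO R :=
  ∑ i, (C (a i) * del R (-1) * C (b i) - (-1 : ℤ) ^ k • (C (b i) * del R (-1) * C (a i)))

/-- CKP eigenfunctions: `f_{t_n} = (L^n)_{≥0}(f)` for all odd `n`. -/
def IsEigenfunction (t : OddTimes R) (L : PDO R) (f : R) : Prop :=
  ∀ n : ℕ, Odd n → t.d n f = (L ^ n).applyNonneg f

/-- `L = ∂ + ∑_{i ≥ 1} u_{i+1} ∂^{-i}` together with `q_{1,i}, q_{2,i}` solves the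
`(k,m)`-constrained CKP hierarchy. -/
structure IsConstrainedCKP (t : OddTimes R) (k m : ℕ) (L : PDO R) (q₁ q₂ : Fin m → R) : Prop where
  coeff_of_one_lt : ∀ n : ℤ, 1 < n → L.coeff n = 0
  coeff_one : L.coeff 1 = 1
  coeff_zero : L.coeff 0 = 0
  adjoint_eq : L.adjoint = -L
  lax : ∀ n : ℕ, Odd n → L.mapDeriv (t.d n) = (L ^ n).nonneg * L - L * (L ^ n).nonneg
  constraint : (L ^ k).neg = constraintForm k q₁ q₂
  eigen₁ : ∀ i, IsEigenfunction t L (q₁ i)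
  eigen₂ : ∀ i, IsEigenfunction t L (q₂ i)

/-- `ω` is a squared eigenfunction potential of `f` and `g`:
`ω_{t_n} = Res_∂ (∂^{-1} g L^n f ∂^{-1})` for all odd `n` (for `n = 1`: `ω_x = f g`).
It is determined up to an integration constant. -/
def IsSEP (t : OddTimes R) (L : PDO R) (f g ω : R) : Prop :=
  ∀ n : ℕ, Odd n → t.d n ω = (del R (-1) * C g * L ^ n * C f * del R (-1)).res

/-- The function `L^k(f) = (L^k)_{≥0}(f) + ∑_i (q_{1,i} Ω(q_{2,i}, f) - (-1)^k q_{2,i} Ω(q_{1,i}, f))`,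
where `∂^{-1}(q f)` is read as the chosen potential `Ω(q, f)`. -/
noncomputable def powApply (Ω : R → R → R) (L : PDO R) (k : ℕ) {m : ℕ} (q₁ q₂ : Fin m → R)
    (f : R) : R :=
  (L ^ k).applyNonneg f + ∑ i, (q₁ i * Ω (q₂ i) f - (-1) ^ k * (q₂ i * Ω (q₁ i) f))

/-- The function `(∂^{-1} f L^k)(g)`, where `∂^{-1} f L^k` is first put in the normal form
`(∂^{-1} f L^k)_{≥0} + ∑_i (Ω(f,q_{1,i}) ∂^{-1} q_{2,i} - (-1)^k Ω(f,q_{2,i}) ∂^{-1} q_{1,i})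
  + (-1)^k ∂^{-1} L^k(f)`
(using `(L^k)^* = (-1)^k L^k` and `∂^{-1} f q ∂^{-1} = Ω(f,q) ∂^{-1} - ∂^{-1} Ω(f,q)`)
and then applied to `g`; `(∂^{-1} f L^k)_{≥0}(g)` is `Res_∂ (∂^{-1} f L^k g ∂^{-1})`. -/
noncomputable def invPowApply (Ω : R → R → R) (L : PDO R) (k : ℕ) {m : ℕ} (q₁ q₂ : Fin m → R)
    (f g : R) : R :=
  (del R (-1) * C f * L ^ k * C g * del R (-1)).res
    + ∑ i, (Ω f (q₁ i) * Ω (q₂ i) g - (-1) ^ k * (Ω f (q₂ i) * Ω (q₁ i) g))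
    + (-1) ^ k * Ω (powApply Ω L k q₁ q₂ f) g

end CKP

/-! ### KP Darboux transformations -/

/-- A (multi-step) KP Darboux transformation `T`. For original eigenfunctions `φ` and adjoint
eigenfunctions `ψ` it records the operator `op = T`, the transformed functions `app φ = T(φ)` and
`adj ψ = (T^{-1})^*(ψ)`, and the potential `pot φ ψ` of the pair `T(φ)`, `(T^{-1})^*(ψ)`. -/
structure DarbouxData (R : Type*) [CommRing R] where
  op : PDO R
  app : R → R
  adj : R → R
  pot : R → R → R

namespace DarbouxData

variable {R : Type*} [CommRing R] [Differential R]

open PDO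

/-- The identity transformation, with the initial potentials `Ω`. -/
def init (Ω : R → R → R) : DarbouxData R where
  op := 1
  app := id
  adj := id
  pot := Ω

/-- Compose `T` with `T_D[f] = f ∂ f⁻¹`, `f = T(f₀)`, so that
`φ ↦ f (φ / f)_x`, `ψ ↦ - f⁻¹ Ω(f, ψ)` and `Ω(φ, ψ) ↦ Ω(φ, ψ) - φ f⁻¹ Ω(f, ψ)`. -/
noncomputable def stepD (T : DarbouxData R) (f₀ : R) : DarbouxData R where
  op := C (T.app f₀) * del R 1 * C (Ring.inverse (T.app f₀)) * T.op
  app φ := T.app f₀ * Differential.deriv (T.app φ * Ring.inverse (T.app f₀))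
  adj ψ := -(Ring.inverse (T.app f₀) * T.pot f₀ ψ)
  pot φ ψ := T.pot φ ψ - T.app φ * Ring.inverse (T.app f₀) * T.pot f₀ ψ

/-- Compose `T` with `T_I[g] = g⁻¹ ∂⁻¹ g`, `g = (T⁻¹)^*(g₀)`, so that
`φ ↦ g⁻¹ Ω(φ, g)`, `ψ ↦ - g (ψ / g)_x` and `Ω(φ, ψ) ↦ Ω(φ, ψ) - ψ g⁻¹ Ω(φ, g)`. -/
noncomputable def stepI (T : DarbouxData R) (g₀ : R) : DarbouxData R where
  op := C (Ring.inverse (T.adj g₀)) * del R (-1) * C (T.adj g₀) * T.op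
  app φ := Ring.inverse (T.adj g₀) * T.pot φ g₀
  adj ψ := -(T.adj g₀ * Differential.deriv (T.adj ψ * Ring.inverse (T.adj g₀)))
  pot φ ψ := T.pot φ ψ - T.adj ψ * Ring.inverse (T.adj g₀) * T.pot φ g₀

/-- `T^{[n,p]}(f_1,…,f_n; g_1,…,g_p) = T_I[g_p^{[n+p-1]}] ⋯ T_I[g_1^{[n]}] T_D[f_n^{[n-1]}] ⋯ T_D[f_1]`
for `fs = [f_1,…,f_n]` and `gs = [g_1,…,g_p]`. -/
noncomputable def multi (Ω : R → R → R) (fs gs : List R) : DarbouxData R :=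
  gs.foldl stepI (fs.foldl stepD (init Ω))

/-- All functions that are inverted in the construction of `multi Ω fs gs`, namely
`f_i^{[i-1]}` and `g_j^{[n+j-1]}`, are invertible. -/
def IsDefined (Ω : R → R → R) (fs gs : List R) : Prop :=
  (∀ (i : ℕ) (h : i < fs.length), IsUnit ((multi Ω (fs.take i) []).app fs[i])) ∧
  (∀ (j : ℕ) (h : j < gs.length), IsUnit ((multi Ω fs (gs.take j)).adj gs[j]))

/-- The CKP Darboux transformation `T^{M} = T^{[M,M]}(f_1,…,f_M; f_1,…,f_M)`. -/
noncomputable def ckp (Ω : R → R → R) {M : ℕ} (f : Fin M → R) : DarbouxData R :=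
  multi Ω (List.ofFn f) (List.ofFn f)

/-- `T^{[M∖{j},M]} = T^{[M-1,M]}(f_1,…,f_{j-1},f_{j+1},…,f_M; f_1,…,f_M)`. -/
noncomputable def ckpDrop (Ω : R → R → R) {M : ℕ} (f : Fin M → R) (j : Fin M) : DarbouxData R :=
  multi Ω ((List.ofFn f).eraseIdx j) (List.ofFn f)

end DarbouxData

/-!
The proof works at the level of a single variable: of the evolution equations only `∂_{t₁} = ∂ₓ` is
needed, which turns the squared eigenfunction potentials into primitives, `Ω(φ, f_j)_x = φ f_j`.

Pseudo-differential operators form a ring (`PDO.mul_assoc`, proved for the left factors `a` and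
`∂^{±1}` by the Leibniz and Pascal rules and extended by truncation), on which the formal adjoint
reverses products (`PDO.adjoint_mul`). The rule used throughout is
`∂⁻¹ ω_x ∂⁻¹ = ω ∂⁻¹ - ∂⁻¹ ω` (`PDO.kernel_mul_kernel`).

*Shape of the Darboux operators.* Every `T^{[n,p]}` built from the `f_i` is an invertible monic
operator of order `n - p` of the form `E + ∑_j β_j ∂⁻¹ f_j` with `E` differential, its action on
functions being obtained by reading `∂⁻¹(f_j φ)` as `Ω(φ, f_j)`, and it annihilates the `f_i` used
in its first `n` steps. This is an induction over the steps (`DarbouxInvariant`), in which the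
potentials `φ ↦ Ω(T φ, (T⁻¹)^* f_j)` have to be carried along as the action of an operator `P` with
`∂ P = ((T⁻¹)^* f_j) T`. No determinants are needed:

* For `n = p = M` the order is `0`, so `T = 1 - ∑_j g_j ∂⁻¹ f_j`, and `T(f_i) = 0` says that the
  symmetric matrix `W = (Ω(f_i, f_j))` satisfies `W g = f` (`exists_ckp_eq`). Then
  `1 + ∑_j f_j ∂⁻¹ g_j` is the inverse of `T` (`binary_mul_inverse`).
* For `T^{[M∖{j},M]} = ∑_l σ_l ∂⁻¹ f_l` monicity says `σ · f = 1`, and annihilation says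
  `W σ = h e_j` with `h = T^{[M∖{j},M]}(f_j)`. Hence `h g_j = (W σ) · g = σ · f = 1`
  (`ckpDrop_app_mul`), which identifies the functions `h⁻¹` of the theorem with the `g_j`.

*Dressing.* Since `(L^k)^* = (-1)^k L^k`, the integral part of `∂⁻¹ f_j L^k` is known in closed form
(`neg_del_mul_pow`). Multiplying out `T L^k T⁻¹` and collecting the coefficients of the `∂⁻¹ g_i`
gives the claim (`neg_dressing`); the consistent choice of integration constants enters exactly in
recognising the coefficient of `∂⁻¹ g_i` as `T(L^k(f_i))`.
-/

/-! ### The ring of pseudo-differential operators -/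

namespace PDO

section Coeff

variable {R : Type*} [CommRing R]

@[ext]
theorem ext {A B : PDO R} (h : ∀ n, A.coeff n = B.coeff n) : A = B :=
  Subtype.ext (funext h)

@[simp] theorem coeff_zero (n : ℤ) : (0 : PDO R).coeff n = 0 := rfl

@[simp] theorem coeff_add (A B : PDO R) (n : ℤ) : (A + B).coeff n = A.coeff n + B.coeff n := rfl

@[simp] theorem coeff_neg (A : PDO R) (n : ℤ) : (-A).coeff n = -A.coeff n := rfl

@[simp] theorem coeff_sub (A B : PDO R) (n : ℤ) : (A - B).coeff n = A.coeff n - B.coeff n := rfl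

/-- Taking the coefficient of `∂^n`, as an additive map. -/
def coeffHom (n : ℤ) : PDO R →+ R where
  toFun A := A.coeff n
  map_zero' := rfl
  map_add' _ _ := rfl

theorem coeff_sum {ι : Type*} (s : Finset ι) (F : ι → PDO R) (n : ℤ) :
    (∑ i ∈ s, F i).coeff n = ∑ i ∈ s, (F i).coeff n :=
  map_sum (coeffHom n) F s

theorem coeff_monomial (i : ℤ) (a : R) (n : ℤ) :
    (monomial i a).coeff n = if n = i then a else 0 := rfl

theorem coeff_C (a : R) (n : ℤ) : (C a).coeff n = if n = 0 then a else 0 := rfl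

theorem coeff_del (i n : ℤ) : (del R i).coeff n = if n = i then 1 else 0 := rfl

theorem coeff_one (n : ℤ) : (1 : PDO R).coeff n = if n = 0 then 1 else 0 := rfl

theorem coeff_neg_part (A : PDO R) (n : ℤ) : A.neg.coeff n = if n < 0 then A.coeff n else 0 := rfl

theorem coeff_nonneg_part (A : PDO R) (n : ℤ) :
    A.nonneg.coeff n = if 0 ≤ n then A.coeff n else 0 := rfl

theorem nonneg_add_neg (A : PDO R) : A.nonneg + A.neg = A := by
  ext n
  rw [coeff_add, coeff_nonneg_part, coeff_neg_part]
  by_cases h : 0 ≤ n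
  · simp [h, not_lt.2 h]
  · simp [h, not_le.1 h]

/-- `A` has order at most `N`. -/
def OrdLE (A : PDO R) (N : ℤ) : Prop := ∀ n, N < n → A.coeff n = 0

theorem exists_ordLE (A : PDO R) : ∃ N, A.OrdLE N := A.exists_bound

theorem OrdLE.add {A B : PDO R} {N : ℤ} (hA : A.OrdLE N) (hB : B.OrdLE N) : (A + B).OrdLE N :=
  fun n hn => by rw [coeff_add, hA n hn, hB n hn, add_zero]

theorem OrdLE.sum {ι : Type*} {s : Finset ι} {F : ι → PDO R} {N : ℤ}
    (h : ∀ i ∈ s, (F i).OrdLE N) : (∑ i ∈ s, F i).OrdLE N := fun n hn => by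
  rw [coeff_sum]
  exact Finset.sum_eq_zero fun i hi => h i hi n hn

theorem ordLE_monomial (i : ℤ) (a : R) : (monomial i a).OrdLE i :=
  fun _ hn => if_neg (ne_of_gt hn)

theorem ordLE_C (a : R) : (C a).OrdLE 0 := ordLE_monomial 0 a

theorem ordLE_del (i : ℤ) : (del R i).OrdLE i := ordLE_monomial i 1

/-- Additive maps which agree on all `a ∂^i`, and whose values have coefficients insensitive to
terms of sufficiently low order, are equal. -/
theorem addHom_ext {F G : PDO R →+ PDO R}
    (hmon : ∀ i a, F (monomial i a) = G (monomial i a))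
    (hlow : ∀ n, ∃ K : ℤ, ∀ A : PDO R, A.OrdLE K → (F A).coeff n = (G A).coeff n) : F = G := by
  ext A n
  obtain ⟨N, hN⟩ := A.exists_ordLE
  obtain ⟨K, hK⟩ := hlow n
  set S : PDO R := ∑ i ∈ Finset.Ioc K N, monomial i (A.coeff i) with hS
  have hlowA : (A - S).OrdLE K := by
    intro j hj
    rw [coeff_sub, hS, coeff_sum]
    simp only [coeff_monomial, Finset.sum_ite_eq, Finset.mem_Ioc, hj, true_and]
    split_ifs with h
    · exact sub_self _
    · rw [hN j (not_le.1 h), sub_zero]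
  have hA : A = S + (A - S) := (add_sub_cancel S A).symm
  rw [hA, map_add, map_add, coeff_add, coeff_add, hK _ hlowA, hS, map_sum, map_sum,
    Finset.sum_congr rfl fun i _ => hmon i (A.coeff i)]

theorem monomial_add (i : ℤ) (a b : R) : monomial i (a + b) = monomial i a + monomial i b := by
  ext n
  simp only [coeff_add, coeff_monomial]
  split_ifs <;> simp

end Coeff

section Mul

variable {R : Type*} [CommRing R] [Differential R]

local notation "D" => (Differential.deriv (R := R))

theorem coeff_mul (A B : PDO R) (n : ℤ) :
    (A * B).coeff n = ∑ᶠ p : ℤ × ℕ, (Ring.choose p.1 p.2 : ℤ) •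
      (A.coeff p.1 * D^[p.2] (B.coeff (n - p.1 + p.2))) := rfl

theorem finite_support_mul (A B : PDO R) (n : ℤ) (c : ℤ × ℕ → ℤ) (s : ℤ × ℕ → ℕ) :
    (Function.support fun p : ℤ × ℕ => c p •
      (A.coeff p.1 * D^[s p] (B.coeff (n - p.1 + p.2)))).Finite := by
  obtain ⟨N, hN⟩ := A.exists_ordLE
  obtain ⟨K, hK⟩ := B.exists_ordLE
  refine ((Set.finite_Icc (n - K) N).prod (Set.finite_Iic (N + K - n).toNat)).subset ?_
  intro p hp
  have h1 : p.1 ≤ N := by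
    by_contra h
    exact hp (by simp [hN _ (not_le.1 h)])
  have h2 : n - p.1 + p.2 ≤ K := by
    by_contra h
    refine hp ?_
    simp only
    rw [hK _ (not_le.1 h), iterate_map_zero]
    simp
  simp only [Set.mem_prod, Set.mem_Icc, Set.mem_Iic]
  omega

theorem OrdLE.mul {A B : PDO R} {N K : ℤ} (hA : A.OrdLE N) (hB : B.OrdLE K) :
    (A * B).OrdLE (N + K) := by
  intro n hn
  rw [coeff_mul]
  refine (finsum_congr fun p => ?_).trans finsum_zero
  by_cases h : N < p.1
  · simp [hA _ h]
  · rw [hB (n - p.1 + p.2) (by omega), iterate_map_zero]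
    simp

/-- The top coefficient of a product is the product of the top coefficients. -/
theorem coeff_mul_top {A B : PDO R} {N K : ℤ} (hA : A.OrdLE N) (hB : B.OrdLE K) :
    (A * B).coeff (N + K) = A.coeff N * B.coeff K := by
  rw [coeff_mul, finsum_eq_single _ ((N, 0) : ℤ × ℕ)]
  · simp
  · rintro ⟨i, l⟩ hne
    by_cases h : N < i
    · simp [hA _ h]
    · have : K < N + K - i + l := by
        rcases Nat.eq_zero_or_pos l with rfl | hl
        · have : i ≠ N := fun h => hne (by rw [h])
          omega
        · omega
      simp only
      rw [hB _ this, iterate_map_zero]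
      simp

protected theorem add_mul (A B X : PDO R) : (A + B) * X = A * X + B * X := by
  ext n
  rw [coeff_add, coeff_mul, coeff_mul, coeff_mul,
    ← finsum_add_distrib (finite_support_mul A X n _ _) (finite_support_mul B X n _ _)]
  refine finsum_congr fun p => ?_
  rw [coeff_add, add_mul, smul_add]

protected theorem mul_add (X A B : PDO R) : X * (A + B) = X * A + X * B := by
  ext n
  rw [coeff_add, coeff_mul, coeff_mul, coeff_mul,
    ← finsum_add_distrib (finite_support_mul X A n _ _) (finite_support_mul X B n _ _)]
  refine finsum_congr fun p => ?_
  rw [coeff_add, iterate_map_add, mul_add, smul_add]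

theorem finsum_eq_finsum_comp {α β M : Type*} [AddCommMonoid M] {f : α → M} {e : β → α}
    (he : Function.Injective e) (hf : ∀ x, x ∉ Set.range e → f x = 0) :
    ∑ᶠ x, f x = ∑ᶠ y, f (e y) := by
  rw [← finsum_mem_range he]
  refine finsum_congr fun x => ?_
  by_cases hx : x ∈ Set.range e
  · simp only [hx, finsum_true]
  · simp only [hx, finsum_false, hf x hx]

/-- The coefficients of `a ∂^i B`. -/
theorem coeff_monomial_mul (i : ℤ) (a : R) (B : PDO R) (n : ℤ) :
    (monomial i a * B).coeff n =
      ∑ᶠ l : ℕ, (Ring.choose i l : ℤ) • (a * D^[l] (B.coeff (n - i + l))) := by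
  rw [coeff_mul, finsum_eq_finsum_comp (e := fun l : ℕ => ((i, l) : ℤ × ℕ))]
  · simp [coeff_monomial]
  · intro a b h
    simpa using h
  · rintro ⟨j, l⟩ h
    have hj : j ≠ i := fun h' => h ⟨l, by rw [h']⟩
    simp [coeff_monomial, hj]

theorem coeff_C_mul (a : R) (B : PDO R) (n : ℤ) : (C a * B).coeff n = a * B.coeff n := by
  rw [C, coeff_monomial_mul, finsum_eq_single _ 0]
  · simp
  · intro l hl
    obtain ⟨l, rfl⟩ := Nat.exists_eq_succ_of_ne_zero hl
    rw [Nat.succ_eq_add_one, Ring.choose_zero_succ, zero_smul]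

protected theorem one_mul (B : PDO R) : 1 * B = B := by
  ext n
  exact (coeff_C_mul 1 B n).trans (one_mul _)

/-- `∂ B = B_x + B̂`, where `B̂` is `B` with all exponents raised by one. -/
theorem coeff_del_one_mul (B : PDO R) (n : ℤ) :
    (del R 1 * B).coeff n = D (B.coeff n) + B.coeff (n - 1) := by
  rw [del, coeff_monomial_mul, finsum_eq_sum_of_support_subset (s := Finset.range 2)]
  · simp [Finset.sum_range_succ, add_comm]
  · intro l hl
    by_contra h
    refine hl ?_
    have h2 : 1 < l := by simpa using h
    have := Ring.choose_natCast (R := ℤ) 1 l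
    rw [Nat.choose_eq_zero_of_lt h2] at this
    simp only [Nat.cast_one, Nat.cast_zero] at this
    simp [this]

/-- Coefficients of `A a`. -/
theorem coeff_mul_C (A : PDO R) (a : R) (n : ℤ) :
    (A * C a).coeff n = ∑ᶠ l : ℕ, (Ring.choose (n + l) l : ℤ) • (A.coeff (n + l) * D^[l] a) := by
  rw [coeff_mul, finsum_eq_finsum_comp (e := fun l : ℕ => ((n + l, l) : ℤ × ℕ))]
  · refine finsum_congr fun l => ?_
    simp [coeff_C]
  · intro a b h
    simpa using congrArg Prod.snd h
  · rintro ⟨j, l⟩ h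
    have hj : n - j + l ≠ 0 := fun h' => h ⟨l, by simp only [Prod.mk.injEq, and_true]; omega⟩
    simp only [coeff_C, if_neg hj, iterate_map_zero, mul_zero, smul_zero]

protected theorem mul_one (A : PDO R) : A * 1 = A := by
  ext n
  refine (coeff_mul_C A 1 n).trans ?_
  rw [finsum_eq_single _ 0]
  · simp
  · intro l hl
    obtain ⟨l, rfl⟩ := Nat.exists_eq_succ_of_ne_zero hl
    rw [Function.iterate_succ_apply, Derivation.map_one_eq_zero, iterate_map_zero, mul_zero,
      smul_zero]

theorem C_mul_assoc (a : R) (A B : PDO R) : C a * A * B = C a * (A * B) := by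
  ext n
  rw [coeff_C_mul, coeff_mul, coeff_mul, mul_finsum' _ _ (finite_support_mul A B n _ _)]
  refine finsum_congr fun p => ?_
  rw [coeff_C_mul, mul_smul_comm, mul_assoc]

/-- Associativity of the product for left factor `∂`: this is the Leibniz rule for the
coefficients combined with Pascal's rule `(i+1 choose l+1) = (i choose l) + (i choose l+1)`. -/
theorem del_one_mul_assoc (A B : PDO R) : del R 1 * A * B = del R 1 * (A * B) := by
  set S : PDO R := del R 1 * A - A.mapDeriv D with hS
  have hScoeff : ∀ n, S.coeff n = A.coeff (n - 1) := fun n => by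
    rw [hS, coeff_sub, coeff_del_one_mul]
    exact add_sub_cancel_left _ _
  have hdel : del R 1 * A = A.mapDeriv D + S := (add_sub_cancel _ _).symm
  ext n
  rw [coeff_del_one_mul, hdel, PDO.add_mul, coeff_add]
  have h1 : D ((A * B).coeff n) = (A.mapDeriv D * B).coeff n +
      ∑ᶠ p : ℤ × ℕ, (Ring.choose p.1 p.2 : ℤ) •
        (A.coeff p.1 * D^[p.2 + 1] (B.coeff (n - p.1 + p.2))) := by
    rw [coeff_mul, coeff_mul, ← finsum_add_distrib (finite_support_mul _ B n _ _)
      (finite_support_mul A B n _ fun p => p.2 + 1)]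
    refine (AddMonoidHom.map_finsum (D : R →+ R) (finite_support_mul A B n _ _)).trans ?_
    refine finsum_congr fun p => ?_
    rw [← smul_add]
    refine (map_zsmul D _ _).trans ?_
    rw [Derivation.leibniz, smul_eq_mul, smul_eq_mul, Function.iterate_succ_apply', add_comm]
    congr 2
    exact mul_comm _ _
  have h2 : (S * B).coeff n = ∑ᶠ p : ℤ × ℕ, (Ring.choose (p.1 + 1) p.2 : ℤ) •
      (A.coeff p.1 * D^[p.2] (B.coeff (n - 1 - p.1 + p.2))) := by
    rw [coeff_mul, ← finsum_comp_equiv ((Equiv.addRight (1 : ℤ)).prodCongr (Equiv.refl ℕ))]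
    refine finsum_congr fun p => ?_
    simp only [Equiv.prodCongr_apply, Prod.map_fst, Prod.map_snd, Equiv.coe_addRight,
      Equiv.refl_apply, hScoeff, add_sub_cancel_right]
    rw [show n - (p.1 + 1) + (p.2 : ℤ) = n - 1 - p.1 + p.2 by ring]
  have h3 : (∑ᶠ p : ℤ × ℕ, (Ring.choose p.1 p.2 : ℤ) •
        (A.coeff p.1 * D^[p.2 + 1] (B.coeff (n - p.1 + p.2)))) =
      ∑ᶠ p : ℤ × ℕ, (Ring.choose (p.1 + 1) p.2 - Ring.choose p.1 p.2 : ℤ) •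
      (A.coeff p.1 * D^[p.2] (B.coeff (n - 1 - p.1 + p.2))) := by
    symm
    rw [finsum_eq_finsum_comp (e := fun p : ℤ × ℕ => (p.1, p.2 + 1))]
    · refine finsum_congr fun p => ?_
      simp only
      rw [Ring.choose_succ_succ, add_sub_cancel_right]
      rw [show n - 1 - p.1 + ((p.2 + 1 : ℕ) : ℤ) = n - p.1 + p.2 by push_cast; ring]
    · rintro ⟨i, l⟩ ⟨j, k⟩ h
      simpa using h
    · rintro ⟨i, l⟩ h
      rcases l with _ | l
      · simp
      · exact absurd ⟨(i, l), rfl⟩ h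
  rw [h1, h2, h3, add_assoc, coeff_mul A B (n - 1), ← finsum_add_distrib
    (finite_support_mul A B (n - 1) _ _) (finite_support_mul A B (n - 1) _ _)]
  congr 1
  refine finsum_congr fun p => ?_
  rw [← add_smul, sub_add_cancel]

/-- `∂ X = 0` forces `X = 0`, by looking at the top coefficient. -/
theorem del_one_mul_injective : Function.Injective fun X : PDO R => del R 1 * X := by
  have key : ∀ X : PDO R, (∀ n, D (X.coeff n) + X.coeff (n - 1) = 0) → ∀ n, X.coeff n = 0 := by
    intro X hX n
    obtain ⟨N, hN⟩ := X.exists_ordLE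
    have : ∀ j : ℕ, X.coeff (N + 1 - j) = 0 := by
      intro j
      induction j with
      | zero => exact hN _ (by simp)
      | succ j ih =>
        have := hX (N + 1 - j)
        rw [ih, map_zero, zero_add] at this
        rw [← this]
        congr 1
        push_cast
        ring
    by_cases h : N < n
    · exact hN n h
    · have := this (N + 1 - n).toNat
      rwa [Int.toNat_of_nonneg (by omega), sub_sub_cancel] at this
  intro X Y hXY
  ext n
  refine sub_eq_zero.1 (key (X - Y) (fun n => ?_) n)
  have := congrArg (fun Z : PDO R => Z.coeff n) hXY
  simp only [coeff_del_one_mul] at this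
  rw [coeff_sub, coeff_sub, map_sub, ← sub_eq_zero.2 this]
  ring

theorem del_one_mul_del (i : ℤ) : del R 1 * del R i = del R (i + 1) := by
  ext n
  rw [coeff_del_one_mul, coeff_del, coeff_del, coeff_del]
  have : D (if n = i then (1 : R) else 0) = 0 := by split_ifs <;> simp
  rw [this, zero_add]
  congr 1
  simp only [eq_iff_iff]
  omega

theorem del_mul_assoc (i : ℤ) (A B : PDO R) : del R i * A * B = del R i * (A * B) := by
  have up : ∀ j : ℤ, (∀ A B : PDO R, del R j * A * B = del R j * (A * B)) →
      ∀ A B : PDO R, del R (j + 1) * A * B = del R (j + 1) * (A * B) := by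
    intro j h A B
    rw [← del_one_mul_del, del_one_mul_assoc, del_one_mul_assoc, del_one_mul_assoc, h]
  have down : ∀ j : ℤ, (∀ A B : PDO R, del R (j + 1) * A * B = del R (j + 1) * (A * B)) →
      ∀ A B : PDO R, del R j * A * B = del R j * (A * B) := by
    intro j h A B
    apply del_one_mul_injective
    simp only
    rw [← del_one_mul_assoc, ← del_one_mul_assoc, ← del_one_mul_assoc, del_one_mul_del, h]
  induction i using Int.induction_on generalizing A B with
  | zero => exact (congrArg (· * B) (PDO.one_mul A)).trans (PDO.one_mul _).symm
  | succ i ih => exact up _ ih A B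
  | pred i ih => exact down _ (by simpa using ih) A B

theorem C_mul_del (a : R) (i : ℤ) : C a * del R i = monomial i a := by
  ext n
  rw [coeff_C_mul, coeff_del, coeff_monomial]
  split_ifs <;> simp

/-- Left multiplication, as an additive map. -/
noncomputable def mulLeftHom (A : PDO R) : PDO R →+ PDO R :=
  AddMonoidHom.mk' (fun B => A * B) (PDO.mul_add A)

/-- Right multiplication, as an additive map. -/
noncomputable def mulRightHom (B : PDO R) : PDO R →+ PDO R :=
  AddMonoidHom.mk' (fun A => A * B) fun A A' => PDO.add_mul A A' B

/-- Associativity is checked for left factors `a` and `∂^i`; both sides depend only on finitely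
many terms of the left factor in each degree. -/
protected theorem mul_assoc (A B X : PDO R) : A * B * X = A * (B * X) := by
  refine DFunLike.congr_fun (addHom_ext (F := (mulRightHom X).comp (mulRightHom B))
    (G := mulRightHom (B * X)) ?_ ?_) A
  · intro i a
    change monomial i a * B * X = monomial i a * (B * X)
    rw [← C_mul_del, C_mul_assoc, C_mul_assoc, C_mul_assoc, del_mul_assoc]
  · intro n
    obtain ⟨N, hN⟩ := B.exists_ordLE
    obtain ⟨K, hK⟩ := X.exists_ordLE
    refine ⟨n - N - K - 1, fun A hA => ?_⟩
    exact ((hA.mul hN).mul hK n (by omega)).trans (hA.mul (hN.mul hK) n (by omega)).symm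

/-- The ring structure on pseudo-differential operators. It is activated locally, so that the
operations of `PDO R` keep their original instances elsewhere. -/
noncomputable abbrev ring (R : Type*) [CommRing R] [Differential R] : Ring (PDO R) where
  __ := (inferInstance : AddCommGroup (PDO R))
  left_distrib := PDO.mul_add
  right_distrib := PDO.add_mul
  zero_mul A := (mulRightHom A).map_zero
  mul_zero A := (mulLeftHom A).map_zero
  mul_assoc := PDO.mul_assoc
  one_mul := PDO.one_mul
  mul_one := PDO.mul_one
  npow n A := A ^ n
  npow_zero _ := rfl
  npow_succ _ _ := rfl

end Mul

end PDO

/-! ### Functions, powers of `∂`, and differential operators -/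

namespace PDO

section Coeff

variable {R : Type*} [CommRing R]

theorem C_one : C (1 : R) = 1 := rfl

theorem del_zero : del R 0 = 1 := rfl

theorem C_add (a b : R) : C (a + b) = C a + C b := monomial_add 0 a b

theorem C_zero : C (0 : R) = 0 := by
  ext n
  simp [coeff_C]

theorem C_neg (a : R) : C (-a) = -C a := by
  ext n
  simp only [coeff_neg, coeff_C]
  split_ifs <;> simp

theorem C_sub (a b : R) : C (a - b) = C a - C b := by
  rw [sub_eq_add_neg, sub_eq_add_neg, C_add, C_neg]

theorem C_sum {ι : Type*} (s : Finset ι) (F : ι → R) : C (∑ i ∈ s, F i) = ∑ i ∈ s, C (F i) :=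
  map_sum (AddMonoidHom.mk' C C_add) F s

/-- `A` is a differential operator: it contains no negative powers of `∂`. -/
def IsDiff (A : PDO R) : Prop := ∀ n : ℤ, n < 0 → A.coeff n = 0

theorem isDiff_C (a : R) : (C a).IsDiff := fun _ hn => if_neg (ne_of_lt hn)

theorem isDiff_zero : (0 : PDO R).IsDiff := fun _ _ => rfl

theorem isDiff_one : (1 : PDO R).IsDiff := isDiff_C 1

theorem isDiff_del_one : (del R 1).IsDiff := fun _ hn => if_neg (by omega)

theorem isDiff_nonneg (A : PDO R) : A.nonneg.IsDiff := fun _ hn => if_neg (by omega)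

theorem IsDiff.add {A B : PDO R} (hA : A.IsDiff) (hB : B.IsDiff) : (A + B).IsDiff :=
  fun n hn => by rw [coeff_add, hA n hn, hB n hn, add_zero]

theorem IsDiff.sub {A B : PDO R} (hA : A.IsDiff) (hB : B.IsDiff) : (A - B).IsDiff :=
  fun n hn => by rw [coeff_sub, hA n hn, hB n hn, sub_zero]

theorem IsDiff.sum {ι : Type*} {s : Finset ι} {A : ι → PDO R} (h : ∀ i ∈ s, (A i).IsDiff) :
    (∑ i ∈ s, A i).IsDiff := fun n hn => by
  rw [coeff_sum]
  exact Finset.sum_eq_zero fun i hi => h i hi n hn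

theorem IsDiff.neg_part {A : PDO R} (hA : A.IsDiff) : A.neg = 0 := by
  ext n
  rw [coeff_neg_part]
  split_ifs with h
  · exact hA n h
  · rfl

theorem OrdLE.neg_part {A : PDO R} (hA : A.OrdLE (-1)) : A.neg = A := by
  ext n
  rw [coeff_neg_part]
  split_ifs with h
  · rfl
  · exact (hA n (by omega)).symm

theorem ordLE_neg_part (A : PDO R) : A.neg.OrdLE (-1) := fun _ hn => if_neg (by omega)

theorem add_neg_part (A B : PDO R) : (A + B).neg = A.neg + B.neg := by
  ext n
  simp only [coeff_neg_part, coeff_add]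
  split_ifs <;> simp

end Coeff

section Mul

attribute [local instance] PDO.ring

variable {R : Type*} [CommRing R] [Differential R]

local notation "D" => (Differential.deriv (R := R))

theorem C_mul (a b : R) : C (a * b) = C a * C b := by
  ext n
  rw [coeff_C_mul, coeff_C, coeff_C]
  split_ifs <;> simp

theorem del_mul_del (i j : ℤ) : del R i * del R j = del R (i + j) := by
  induction i using Int.induction_on with
  | zero => rw [del_zero, one_mul, zero_add]
  | succ i ih => rw [← del_one_mul_del, mul_assoc, ih, del_one_mul_del, add_right_comm]
  | pred i ih =>
    apply del_one_mul_injective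
    simp only
    rw [← mul_assoc, del_one_mul_del, sub_add_cancel, ih, del_one_mul_del]
    congr 1
    ring

@[simp] theorem del_one_mul_del_neg_one : del R 1 * del R (-1) = 1 := del_mul_del 1 (-1)

@[simp] theorem del_neg_one_mul_del_one : del R (-1) * del R 1 = 1 := del_mul_del (-1) 1

/-- The Leibniz rule `∂ a = a ∂ + a_x`. -/
theorem del_one_mul_C (a : R) : del R 1 * C a = C a * del R 1 + C (D a) := by
  ext n
  rw [coeff_del_one_mul, coeff_add, coeff_C_mul, coeff_C, coeff_C, coeff_C, coeff_del, add_comm]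
  congr 1
  · by_cases h : n = 1
    · simp [h]
    · have : n - 1 ≠ 0 := by omega
      simp [h, this]
  · split_ifs <;> simp

theorem coeff_mul_del (A : PDO R) (i n : ℤ) : (A * del R i).coeff n = A.coeff (n - i) := by
  rw [coeff_mul, finsum_eq_single _ ((n - i, 0) : ℤ × ℕ)]
  · simp [coeff_del]
  · rintro ⟨j, l⟩ hne
    simp only [coeff_del]
    rcases l with _ | l
    · have : n - j + ((0 : ℕ) : ℤ) ≠ i := fun h => hne (by
        simp only [Prod.mk.injEq, and_true]
        push_cast at h
        omega)
      rw [if_neg this]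
      simp
    · have : D (if n - j + ((l + 1 : ℕ) : ℤ) = i then (1 : R) else 0) = 0 := by
        split_ifs <;> simp
      rw [Function.iterate_succ_apply, this, iterate_map_zero, mul_zero, smul_zero]

theorem choose_natCast_of_lt {i l : ℕ} (h : i < l) : (Ring.choose (i : ℤ) l : ℤ) = 0 := by
  rw [Ring.choose_natCast, Nat.choose_eq_zero_of_lt h, Nat.cast_zero]

/-- The value of a differential operator on `f` is the constant term of its product with `f`. -/
theorem applyNonneg_eq_coeff (A : PDO R) (f : R) : A.applyNonneg f = (A * C f).coeff 0 := by
  rw [coeff_mul_C, applyNonneg]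
  refine finsum_congr fun l => ?_
  rw [zero_add, Ring.choose_natCast, Nat.choose_self, Nat.cast_one, one_smul]

theorem add_applyNonneg (A B : PDO R) (f : R) :
    (A + B).applyNonneg f = A.applyNonneg f + B.applyNonneg f := by
  simp only [applyNonneg_eq_coeff, add_mul, coeff_add]

theorem sub_applyNonneg (A B : PDO R) (f : R) :
    (A - B).applyNonneg f = A.applyNonneg f - B.applyNonneg f := by
  simp only [applyNonneg_eq_coeff, sub_mul, coeff_sub]

theorem sum_applyNonneg {ι : Type*} (s : Finset ι) (A : ι → PDO R) (f : R) :
    (∑ i ∈ s, A i).applyNonneg f = ∑ i ∈ s, (A i).applyNonneg f := by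
  simp only [applyNonneg_eq_coeff, Finset.sum_mul, coeff_sum]

theorem C_mul_applyNonneg (a : R) (A : PDO R) (f : R) :
    (C a * A).applyNonneg f = a * A.applyNonneg f := by
  rw [applyNonneg_eq_coeff, applyNonneg_eq_coeff, mul_assoc, coeff_C_mul]

theorem C_applyNonneg (a f : R) : (C a).applyNonneg f = a * f := by
  rw [applyNonneg_eq_coeff, coeff_C_mul, coeff_C, if_pos rfl]

theorem one_applyNonneg (f : R) : (1 : PDO R).applyNonneg f = f := by
  rw [← C_one, C_applyNonneg, one_mul]

theorem nonneg_applyNonneg (A : PDO R) (f : R) : A.nonneg.applyNonneg f = A.applyNonneg f := by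
  refine finsum_congr fun i => ?_
  rw [coeff_nonneg_part, if_pos (Int.natCast_nonneg i)]

theorem IsDiff.mul {A B : PDO R} (hA : A.IsDiff) (hB : B.IsDiff) : (A * B).IsDiff := by
  intro n hn
  rw [coeff_mul]
  refine (finsum_congr fun p => ?_).trans finsum_zero
  rcases lt_or_ge p.1 0 with h | h
  · rw [hA _ h, zero_mul, smul_zero]
  · by_cases hB' : n - p.1 + p.2 < 0
    · rw [hB _ hB', iterate_map_zero, mul_zero, smul_zero]
    · obtain ⟨i, hi⟩ := Int.eq_ofNat_of_zero_le h
      rw [hi, choose_natCast_of_lt (by omega), zero_smul]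

/-- The terms `a ∂⁻¹ b` have order at most `-1`. -/
theorem ordLE_mul_del_mul (a b : R) : (C a * del R (-1) * C b).OrdLE (-1) :=
  ((ordLE_C a).mul (ordLE_del (-1))).mul (ordLE_C b)

/-- `E ∂⁻¹ ≡ e₀ ∂⁻¹` modulo differential operators, if `E` is a differential operator with constant
term `e₀`. -/
theorem IsDiff.mul_del_neg_one {E : PDO R} (hE : E.IsDiff) :
    (E * del R (-1) - C (E.coeff 0) * del R (-1)).IsDiff := by
  intro n hn
  rw [coeff_sub, coeff_mul_del, coeff_mul_del, coeff_C, sub_neg_eq_add]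
  split_ifs with h
  · rw [h, sub_self]
  · rw [hE _ (by omega), sub_zero]

/-- `E a ∂⁻¹ b ≡ E(a) ∂⁻¹ b` modulo differential operators, if `E` is a differential operator. -/
theorem IsDiff.mul_kernel {E : PDO R} (hE : E.IsDiff) (a b : R) :
    (E * (C a * del R (-1) * C b) - C (E.applyNonneg a) * del R (-1) * C b).IsDiff := by
  have h := (hE.mul (isDiff_C a)).mul_del_neg_one.mul (isDiff_C b)
  rwa [sub_mul, ← applyNonneg_eq_coeff, mul_assoc E, mul_assoc E] at h

/-- `(∂ E)(f) = (E(f))_x` for a differential operator `E`. -/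
theorem IsDiff.del_one_mul_applyNonneg {E : PDO R} (hE : E.IsDiff) (f : R) :
    (del R 1 * E).applyNonneg f = D (E.applyNonneg f) := by
  rw [applyNonneg_eq_coeff, applyNonneg_eq_coeff, mul_assoc, coeff_del_one_mul,
    hE.mul (isDiff_C f) (0 - 1) (by norm_num), add_zero]

/-- `∂⁻¹ a b ∂⁻¹ = ω ∂⁻¹ - ∂⁻¹ ω` whenever `ω_x = a b`. -/
theorem del_mul_del_of_deriv {ω a b : R} (h : D ω = a * b) :
    del R (-1) * C a * (C b * del R (-1)) = C ω * del R (-1) - del R (-1) * C ω := by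
  have key : C a * C b = del R 1 * C ω - C ω * del R 1 := by
    rw [del_one_mul_C, add_sub_cancel_left, h, C_mul]
  calc del R (-1) * C a * (C b * del R (-1))
      = del R (-1) * (C a * C b) * del R (-1) := by simp only [mul_assoc]
    _ = (del R (-1) * del R 1) * C ω * del R (-1)
          - del R (-1) * C ω * (del R 1 * del R (-1)) := by
        rw [key]
        noncomm_ring
    _ = _ := by simp

/-- The composition rule for two terms `a ∂⁻¹ b` and `c ∂⁻¹ d`, with `ω` a primitive of `b c`. -/
theorem kernel_mul_kernel {ω b c : R} (h : D ω = b * c) (a d : R) :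
    C a * del R (-1) * C b * (C c * del R (-1) * C d) =
      C (a * ω) * del R (-1) * C d - C a * del R (-1) * C (ω * d) := by
  calc C a * del R (-1) * C b * (C c * del R (-1) * C d)
      = C a * (del R (-1) * C b * (C c * del R (-1))) * C d := by simp only [mul_assoc]
    _ = _ := by
      rw [del_mul_del_of_deriv h, C_mul, C_mul]
      noncomm_ring

/-! ### The formal adjoint -/

theorem coeff_adjoint (A : PDO R) (n : ℤ) :
    A.adjoint.coeff n = ∑ᶠ l : ℕ, ((Int.negOnePow (n + l) : ℤ) * Ring.choose (n + l) l) •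
      D^[l] (A.coeff (n + l)) := rfl

theorem OrdLE.adjoint {A : PDO R} {N : ℤ} (hA : A.OrdLE N) : A.adjoint.OrdLE N := by
  intro n hn
  rw [coeff_adjoint]
  refine (finsum_congr fun l => ?_).trans finsum_zero
  rw [hA (n + l) (by omega), iterate_map_zero, smul_zero]

theorem adjoint_add (A B : PDO R) : (A + B).adjoint = A.adjoint + B.adjoint := by
  have fin : ∀ (A : PDO R) (n : ℤ), (Function.support fun l : ℕ =>
      ((Int.negOnePow (n + l) : ℤ) * Ring.choose (n + l) l) • D^[l] (A.coeff (n + l))).Finite := by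
    intro A n
    obtain ⟨N, hN⟩ := A.exists_ordLE
    refine (Set.finite_Iic (N - n).toNat).subset fun l hl => ?_
    have : n + l ≤ N := by
      by_contra h
      refine hl ?_
      simp only
      rw [hN _ (not_le.1 h), iterate_map_zero, smul_zero]
    simp only [Set.mem_Iic]
    omega
  ext n
  rw [coeff_add, coeff_adjoint, coeff_adjoint, coeff_adjoint,
    ← finsum_add_distrib (fin A n) (fin B n)]
  refine finsum_congr fun l => ?_
  rw [coeff_add, iterate_map_add, smul_add]

/-- The formal adjoint as an additive map. -/
noncomputable def adjointHom (R : Type*) [CommRing R] [Differential R] : PDO R →+ PDO R :=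
  AddMonoidHom.mk' adjoint adjoint_add

/-- `(b ∂^i)^* = (-1)^i ∂^i b`. -/
theorem adjoint_monomial (i : ℤ) (b : R) :
    (monomial i b).adjoint = (i.negOnePow : ℤ) • (del R i * C b) := by
  have h : (i.negOnePow : ℤ) • (del R i * C b) = monomial i ((i.negOnePow : ℤ) : R) * C b := by
    rw [← C_mul_del, mul_assoc]
    ext n
    rw [coeff_C_mul]
    exact zsmul_eq_mul _ _
  rw [h]
  ext n
  rw [coeff_adjoint, coeff_monomial_mul]
  refine finsum_congr fun l => ?_
  rw [coeff_monomial, coeff_C]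
  by_cases hl : n + l = i
  · rw [if_pos hl, if_pos (by omega), hl, mul_comm, mul_smul, zsmul_eq_mul (D^[l] b)]
  · rw [if_neg hl, if_neg (by omega), iterate_map_zero, mul_zero, smul_zero, smul_zero]

theorem adjoint_C (a : R) : (C a).adjoint = C a := by
  rw [C, adjoint_monomial, Int.negOnePow_zero, del_zero, one_mul]
  exact one_smul _ _

theorem adjoint_C_mul (a : R) (X : PDO R) : (C a * X).adjoint = X.adjoint * C a := by
  refine DFunLike.congr_fun (addHom_ext (F := (adjointHom R).comp (mulLeftHom (C a)))
    (G := (mulRightHom (C a)).comp (adjointHom R)) ?_ ?_) X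
  · intro i b
    change (C a * monomial i b).adjoint = (monomial i b).adjoint * C a
    rw [← C_mul_del, ← mul_assoc, ← C_mul, C_mul_del, C_mul_del, adjoint_monomial,
      adjoint_monomial, smul_mul_assoc, mul_assoc, ← C_mul, mul_comm a]
  · intro n
    refine ⟨n - 1, fun A hA => ?_⟩
    exact (((ordLE_C a).mul hA).adjoint n (by omega)).trans
      ((hA.adjoint.mul (ordLE_C a)) n (by omega)).symm

theorem adjoint_del_one_mul (X : PDO R) : (del R 1 * X).adjoint = -(X.adjoint * del R 1) := by
  refine DFunLike.congr_fun (addHom_ext (F := (adjointHom R).comp (mulLeftHom (del R 1)))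
    (G := -(mulRightHom (del R 1)).comp (adjointHom R)) ?_ ?_) X
  · intro i b
    change (del R 1 * monomial i b).adjoint = -((monomial i b).adjoint * del R 1)
    have h1 : del R 1 * monomial i b = monomial (i + 1) b + monomial i (D b) := by
      rw [← C_mul_del, ← mul_assoc, del_one_mul_C, add_mul, mul_assoc, del_mul_del, add_comm 1 i,
        C_mul_del, C_mul_del]
    rw [h1, adjoint_add, adjoint_monomial, adjoint_monomial, adjoint_monomial, Int.negOnePow_succ,
      ← del_mul_del i 1, mul_assoc, del_one_mul_C, Units.val_neg, neg_smul, mul_add, smul_add,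
      smul_mul_assoc, mul_assoc]
    abel
  · intro n
    refine ⟨n - 2, fun A hA => ?_⟩
    refine (((ordLE_del 1).mul hA).adjoint n (by omega)).trans ?_
    change 0 = -(A.adjoint * del R 1).coeff n
    rw [(hA.adjoint.mul (ordLE_del 1)) n (by omega), neg_zero]

theorem adjoint_del_mul (i : ℤ) (X : PDO R) :
    (del R i * X).adjoint = (i.negOnePow : ℤ) • (X.adjoint * del R i) := by
  induction i using Int.induction_on with
  | zero =>
    rw [del_zero, one_mul, mul_one, Int.negOnePow_zero]
    exact (one_smul _ _).symm
  | succ i ih =>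
    rw [← del_one_mul_del, mul_assoc, adjoint_del_one_mul, ih, Int.negOnePow_succ, Units.val_neg,
      neg_smul, smul_mul_assoc, mul_assoc, del_mul_del, del_mul_del, add_comm 1]
  | pred i ih =>
    have h : del R (-i) * X = del R 1 * (del R (-i - 1) * X) := by
      rw [← mul_assoc, del_mul_del]
      congr 2
      ring
    rw [h, adjoint_del_one_mul] at ih
    have h2 := congrArg (fun Y => -(Y * del R (-1))) ih
    simp only [neg_mul, neg_neg, mul_assoc, del_mul_del, smul_mul_assoc] at h2
    rw [show (1 : ℤ) + -1 = 0 by ring, del_zero, mul_one, ← sub_eq_add_neg] at h2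
    have h3 : (-(i : ℤ)).negOnePow = -(-(i : ℤ) - 1).negOnePow := by
      rw [← Int.negOnePow_succ, sub_add_cancel]
    rw [h2, h3, Units.val_neg, neg_smul, neg_neg]

/-- The formal adjoint reverses products. -/
theorem adjoint_mul (A B : PDO R) : (A * B).adjoint = B.adjoint * A.adjoint := by
  refine DFunLike.congr_fun (addHom_ext (F := (adjointHom R).comp (mulRightHom B))
    (G := (mulLeftHom B.adjoint).comp (adjointHom R)) ?_ ?_) A
  · intro i a
    change (monomial i a * B).adjoint = B.adjoint * (monomial i a).adjoint
    rw [adjoint_monomial, ← C_mul_del, mul_assoc, adjoint_C_mul, adjoint_del_mul, smul_mul_assoc,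
      mul_smul_comm, mul_assoc]
  · intro n
    obtain ⟨N, hN⟩ := B.exists_ordLE
    refine ⟨n - N - 1, fun A hA => ?_⟩
    exact ((hA.mul hN).adjoint n (by omega)).trans
      ((hN.adjoint.mul hA.adjoint) n (by omega)).symm

theorem adjoint_one : (1 : PDO R).adjoint = 1 := adjoint_C 1

theorem adjoint_pow_of_eq_neg {L : PDO R} (h : L.adjoint = -L) (k : ℕ) :
    (L ^ k).adjoint = (-1 : ℤ) ^ k • L ^ k := by
  induction k with
  | zero => simpa using adjoint_one
  | succ k ih =>
    rw [pow_succ, adjoint_mul, ih, h, pow_succ (-1 : ℤ), mul_neg_one, neg_smul, neg_mul,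
      mul_smul_comm, ← pow_succ', ← pow_succ]

theorem IsDiff.adjoint {A : PDO R} (hA : A.IsDiff) : A.adjoint.IsDiff := by
  intro n hn
  rw [coeff_adjoint]
  refine (finsum_congr fun l => ?_).trans finsum_zero
  rcases lt_or_ge (n + l) 0 with h | h
  · rw [hA _ h, iterate_map_zero, smul_zero]
  · obtain ⟨i, hi⟩ := Int.eq_ofNat_of_zero_le h
    rw [hi, choose_natCast_of_lt (by omega), mul_zero, zero_smul]

/-- The formal adjoint commutes with taking the differential part. -/
theorem adjoint_nonneg_part (A : PDO R) : A.nonneg.adjoint = A.adjoint.nonneg := by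
  ext n
  rw [coeff_nonneg_part]
  split_ifs with h
  · rw [coeff_adjoint, coeff_adjoint]
    refine finsum_congr fun l => ?_
    rw [coeff_nonneg_part, if_pos (by omega)]
  · exact (isDiff_nonneg A).adjoint n (not_le.1 h)

/-- `∂⁻¹ E ≡ ∂⁻¹ E^*(1)` modulo differential operators, if `E` is a differential operator. -/
theorem IsDiff.del_neg_one_mul {E : PDO R} (hE : E.IsDiff) :
    (del R (-1) * E - del R (-1) * C (E.adjoint.coeff 0)).IsDiff := by
  set Q := (del R (-1) * E).nonneg with hQ
  set N := (del R (-1) * E).neg with hN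
  have hQN : del R (-1) * E = Q + N := (nonneg_add_neg _).symm
  have hE' : E = del R 1 * Q + del R 1 * N := by
    rw [← mul_add, ← hQN, ← mul_assoc, del_one_mul_del_neg_one, one_mul]
  -- `∂ N = E - ∂ Q` is a differential operator of order at most `0`, hence a function.
  have hr : del R 1 * N = C ((del R 1 * N).coeff 0) := by
    ext n
    rw [coeff_C]
    split_ifs with h
    · rw [h]
    · rcases lt_or_gt_of_ne h with h | h
      · rw [eq_sub_of_add_eq' hE'.symm]
        exact (hE.sub (isDiff_del_one.mul (isDiff_nonneg _))) n h
      · exact ((ordLE_del 1).mul (ordLE_neg_part _)) n (by omega)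
  have hcoeff : E.adjoint.coeff 0 = (del R 1 * N).coeff 0 := by
    rw [hE', adjoint_add, adjoint_del_one_mul, hr, adjoint_C, coeff_add, coeff_neg, coeff_mul_del,
      (isDiff_nonneg _).adjoint _ (by norm_num), neg_zero, zero_add]
  rw [hcoeff, ← hr, ← mul_assoc, del_neg_one_mul_del_one, one_mul, hQN, add_sub_cancel_right]
  exact isDiff_nonneg _

end Mul

end PDO

/-! ### Operators evaluated through squared eigenfunction potentials -/

section Evaluation

open PDO

attribute [local instance] PDO.ring

variable {R : Type*} [CommRing R] [Differential R] {ι : Type*} [Fintype ι]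

local notation "D" => (Differential.deriv (R := R))

/-- `Ω(φ, f_j)` is a primitive of `φ f_j` for every `j`. -/
def HasPotentials (Ω : R → R → R) (f : ι → R) (φ : R) : Prop :=
  ∀ j, D (Ω φ (f j)) = φ * f j

/-- The function `e` is the action of an operator `P = E + ∑_j β_j ∂⁻¹ f_j`, with `E` a differential
operator, when `∂⁻¹(f_j φ)` is read as `Ω(φ, f_j)`. Since `P` determines neither the coefficients
`β_j` nor the integration constants, this is a relation between `P` and `e`. -/
def Represents (Ω : R → R → R) (f : ι → R) (P : PDO R) (e : R → R) : Prop :=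
  ∃ (E : PDO R) (β : ι → R), E.IsDiff ∧ P = E + ∑ j, C (β j) * del R (-1) * C (f j) ∧
    ∀ φ, HasPotentials Ω f φ → e φ = E.applyNonneg φ + ∑ j, β j * Ω φ (f j)

variable {Ω : R → R → R} {f : ι → R}

theorem Represents.sub {P P' : PDO R} {e e' : R → R} (h : Represents Ω f P e)
    (h' : Represents Ω f P' e') : Represents Ω f (P - P') (fun φ => e φ - e' φ) := by
  obtain ⟨E, β, hE, rfl, he⟩ := h
  obtain ⟨E', β', hE', rfl, he'⟩ := h'
  refine ⟨E - E', fun j => β j - β' j, hE.sub hE', ?_, fun φ hφ => ?_⟩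
  · simp only [C_sub, sub_mul, Finset.sum_sub_distrib]
    abel
  · beta_reduce
    rw [he φ hφ, he' φ hφ, sub_applyNonneg]
    simp only [sub_mul, Finset.sum_sub_distrib]
    ring

theorem Represents.C_mul {P : PDO R} {e : R → R} (h : Represents Ω f P e) (a : R) :
    Represents Ω f (C a * P) (fun φ => a * e φ) := by
  obtain ⟨E, β, hE, rfl, he⟩ := h
  refine ⟨C a * E, fun j => a * β j, (isDiff_C a).mul hE, ?_, fun φ hφ => ?_⟩
  · simp only [PDO.C_mul, mul_add, Finset.mul_sum, mul_assoc]
  · beta_reduce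
    rw [he φ hφ, C_mul_applyNonneg]
    simp only [mul_add, Finset.mul_sum, mul_assoc]

theorem Represents.del_mul {P : PDO R} {e : R → R} (h : Represents Ω f P e) :
    Represents Ω f (del R 1 * P) (fun φ => D (e φ)) := by
  obtain ⟨E, β, hE, rfl, he⟩ := h
  refine ⟨del R 1 * E + ∑ j, C (β j * f j), fun j => D (β j),
    (isDiff_del_one.mul hE).add (IsDiff.sum fun j _ => isDiff_C _), ?_, fun φ hφ => ?_⟩
  · rw [mul_add, Finset.mul_sum, add_assoc, ← Finset.sum_add_distrib]
    congr 1
    refine Finset.sum_congr rfl fun j _ => ?_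
    rw [← mul_assoc, ← mul_assoc, del_one_mul_C, add_mul, add_mul, mul_assoc (C (β j)),
      del_one_mul_del_neg_one, mul_one, PDO.C_mul]
  · beta_reduce
    rw [he φ hφ, map_add, map_sum, add_applyNonneg, hE.del_one_mul_applyNonneg, sum_applyNonneg,
      add_assoc, ← Finset.sum_add_distrib]
    congr 1
    refine Finset.sum_congr rfl fun j _ => ?_
    rw [Derivation.leibniz, hφ j, C_applyNonneg, smul_eq_mul, smul_eq_mul]
    ring

/-- The terms `β_j ∂⁻¹ f_j` have negative order, so a differential operator `B` which agrees with
`P` in nonnegative degrees is the differential part in any such form of `P`. -/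
theorem Represents.exists_of_isDiff_sub {P B : PDO R} {e : R → R} (h : Represents Ω f P e)
    (hB : B.IsDiff) (hPB : (P - B).OrdLE (-1)) :
    ∃ β : ι → R, P = B + ∑ j, C (β j) * del R (-1) * C (f j) ∧
      ∀ φ, HasPotentials Ω f φ → e φ = B.applyNonneg φ + ∑ j, β j * Ω φ (f j) := by
  obtain ⟨E, β, hE, rfl, he⟩ := h
  have hEB : E = B := by
    rw [← sub_eq_zero]
    ext n
    rcases lt_or_ge n 0 with hn | hn
    · exact (hE.sub hB) n hn
    · have h1 := hPB n (by omega)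
      have h2 : (∑ j, C (β j) * del R (-1) * C (f j)).coeff n = 0 :=
        OrdLE.sum (fun j _ => ordLE_mul_del_mul _ _) n (by omega)
      rwa [coeff_sub, coeff_add, h2, add_zero] at h1
  subst hEB
  exact ⟨β, rfl, he⟩

end Evaluation

/-! ### Invariants of the Darboux steps -/

section Invariants

open PDO

attribute [local instance] PDO.ring

variable {R : Type*} [CommRing R] [Differential R] {ι : Type*} [Fintype ι]

local notation "D" => (Differential.deriv (R := R))

/-- The properties of a multi-step Darboux transformation `T` which survive each further step:
`T` and the potentials of `T` against the `f_j` are given by operators of the form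
`E + ∑_j β_j ∂⁻¹ f_j`, the potentials have the right derivative, `T` is invertible and monic of
order `d`, and `T` annihilates the functions in `used` together with their potentials. -/
structure DarbouxInvariant (Ω : R → R → R) (f : ι → R) (used : Set R) (d : ℤ)
    (T : DarbouxData R) : Prop where
  app_rep : Represents Ω f T.op T.app
  pot_rep : ∀ j, ∃ P : PDO R, Represents Ω f P (fun φ => T.pot φ (f j)) ∧
    del R 1 * P = C (T.adj (f j)) * T.op
  deriv_pot : ∀ φ, HasPotentials Ω f φ → ∀ j, D (T.pot φ (f j)) = T.app φ * T.adj (f j)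
  isUnit : IsUnit T.op
  ordLE : T.op.OrdLE d
  coeff_top : T.op.coeff d = 1
  app_eq_zero : ∀ h ∈ used, T.app h = 0
  pot_eq_zero : ∀ h ∈ used, ∀ ψ, T.pot h ψ = 0

theorem isUnit_C {a : R} (ha : IsUnit a) : IsUnit (C a) := by
  obtain ⟨u, rfl⟩ := ha
  refine ⟨⟨C u, C ↑u⁻¹, ?_, ?_⟩, rfl⟩
  · rw [← PDO.C_mul, Units.mul_inv, C_one]
  · rw [← PDO.C_mul, Units.inv_mul, C_one]

theorem isUnit_del (i : ℤ) : IsUnit (del R i) :=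
  ⟨⟨del R i, del R (-i), by rw [del_mul_del, add_neg_cancel, del_zero],
    by rw [del_mul_del, neg_add_cancel, del_zero]⟩, rfl⟩

variable {Ω : R → R → R} {f : ι → R} {used : Set R} {d : ℤ} {T : DarbouxData R}

/-- Conjugates of `∂^i` by invertible functions are invertible and monic, so multiplying by them
shifts the order by `i`. -/
theorem DarbouxInvariant.conj_del_mul (h : DarbouxInvariant Ω f used d T) (i : ℤ) {a b : R}
    (hab : a * b = 1) :
    IsUnit (C a * del R i * C b * T.op) ∧ (C a * del R i * C b * T.op).OrdLE (d + i) ∧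
      (C a * del R i * C b * T.op).coeff (d + i) = 1 := by
  have ha : IsUnit a := IsUnit.of_mul_eq_one b hab
  have hb : IsUnit b := IsUnit.of_mul_eq_one a ((mul_comm b a).trans hab)
  have o1 := (ordLE_C a).mul (ordLE_del i)
  have o2 := o1.mul (ordLE_C b)
  have o3 := o2.mul h.ordLE
  have e : 0 + i + 0 + d = d + i := by ring
  refine ⟨(((isUnit_C ha).mul (isUnit_del i)).mul (isUnit_C hb)).mul h.isUnit, e ▸ o3, ?_⟩
  rw [← e, coeff_mul_top o2 h.ordLE, coeff_mul_top o1 (ordLE_C b),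
    coeff_mul_top (ordLE_C a) (ordLE_del i), h.coeff_top, coeff_C, coeff_C, coeff_del]
  simpa using hab

theorem DarbouxInvariant.init (Ω : R → R → R) (f : ι → R) :
    DarbouxInvariant Ω f ∅ 0 (DarbouxData.init Ω) where
  app_rep := ⟨1, 0, isDiff_one, by simp [DarbouxData.init, C_zero],
    fun φ _ => by simp [DarbouxData.init, one_applyNonneg]⟩
  pot_rep j := by
    classical
    refine ⟨del R (-1) * C (f j), ⟨0, Pi.single j 1, isDiff_zero, ?_, fun φ _ => ?_⟩, ?_⟩
    · rw [Finset.sum_eq_single j]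
      · simp [C_one]
      · intro i _ hi
        simp [Pi.single_eq_of_ne hi, C_zero]
      · simp
    · rw [Finset.sum_eq_single j]
      · simp [DarbouxData.init, applyNonneg]
      · intro i _ hi
        simp [Pi.single_eq_of_ne hi]
      · simp
    · simp [DarbouxData.init, ← mul_assoc]
  deriv_pot φ hφ j := hφ j
  isUnit := isUnit_one
  ordLE := ordLE_C 1
  coeff_top := rfl
  app_eq_zero _ h := h.elim
  pot_eq_zero _ h := h.elim

/-- The invariants survive composition with `T_D[f_i]`, which adds `f_i` to the kernel. -/
theorem DarbouxInvariant.stepD (hf : ∀ i, HasPotentials Ω f (f i))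
    (h : DarbouxInvariant Ω f used d T) (i : ι) (hi : IsUnit (T.app (f i))) :
    DarbouxInvariant Ω f (insert (f i) used) (d + 1) (T.stepD (f i)) := by
  set F := T.app (f i) with hF
  set G := Ring.inverse F with hG
  have hFG : F * G = 1 := Ring.mul_inverse_cancel F hi
  obtain ⟨hu, ho, hc⟩ := h.conj_del_mul 1 hFG
  have hDG : D F * G + F * D G = 0 := by
    have := congrArg D hFG
    rw [Derivation.leibniz, Derivation.map_one_eq_zero, smul_eq_mul, smul_eq_mul] at this
    linear_combination this
  refine ⟨?_, fun j => ?_, fun φ hφ j => ?_, hu, ho, hc, ?_, ?_⟩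
  · have := ((h.app_rep.C_mul G).del_mul).C_mul F
    simp only [← mul_assoc] at this
    have e : (T.stepD (f i)).app = fun φ => F * D (G * T.app φ) :=
      funext fun φ => congrArg (fun y => F * D y) (mul_comm (T.app φ) G)
    rw [e]
    exact this
  · -- `Ω' = Ω - (φ / f) Ω(f, ·)` corresponds to subtracting a multiple of `T` from `P`.
    obtain ⟨P, hP, hdP⟩ := h.pot_rep j
    refine ⟨P - C (G * T.pot (f i) (f j)) * T.op, ?_, ?_⟩
    · convert hP.sub (h.app_rep.C_mul (G * T.pot (f i) (f j))) using 2 with φ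
      change _ - T.app φ * G * _ = _
      ring
    · have hp : D (T.pot (f i) (f j)) = F * T.adj (f j) := h.deriv_pot _ (hf i) j
      change _ = C (-(G * T.pot (f i) (f j))) * (C F * del R 1 * C G * T.op)
      rw [mul_sub, hdP, ← mul_assoc, del_one_mul_C, mul_assoc (C F), del_one_mul_C G]
      set p := T.pot (f i) (f j)
      have e1 : D (G * p) = D G * p + T.adj (f j) := by
        rw [Derivation.leibniz, hp, smul_eq_mul, smul_eq_mul]
        linear_combination T.adj (f j) * hFG
      have e2 : G * p * F = p := by linear_combination p * hFG
      have e3 : C (G * p) * (C F * (C G * del R 1 + C (D G))) =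
          C (G * p) * del R 1 + C (p * D G) := by
        rw [← mul_assoc, ← PDO.C_mul, e2, mul_add, ← mul_assoc, ← PDO.C_mul, ← PDO.C_mul,
          mul_comm p G]
      rw [C_neg, neg_mul, ← mul_assoc, e3, e1, C_add, mul_comm p]
      noncomm_ring
  · have hp : D (T.pot (f i) (f j)) = F * T.adj (f j) := h.deriv_pot _ (hf i) j
    change D (T.pot φ (f j) - T.app φ * G * T.pot (f i) (f j)) =
      (F * D (T.app φ * G)) * -(G * T.pot (f i) (f j))
    rw [map_sub, h.deriv_pot φ hφ j, Derivation.leibniz D (T.app φ * G), hp, smul_eq_mul,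
      smul_eq_mul]
    linear_combination (D (T.app φ * G) * T.pot (f i) (f j) - T.app φ * T.adj (f j)) * hFG
  · rintro g (rfl | hg)
    · change F * D (F * G) = 0
      rw [hFG, Derivation.map_one_eq_zero, mul_zero]
    · change F * D (T.app g * G) = 0
      rw [h.app_eq_zero g hg, zero_mul, map_zero, mul_zero]
  · rintro g (rfl | hg) ψ
    · change T.pot (f i) ψ - F * G * T.pot (f i) ψ = 0
      rw [hFG, one_mul, sub_self]
    · change T.pot g ψ - T.app g * G * T.pot (f i) ψ = 0
      rw [h.app_eq_zero g hg, h.pot_eq_zero g hg, zero_mul, zero_mul, sub_self]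

/-- The invariants survive composition with `T_I[f_i]`. -/
theorem DarbouxInvariant.stepI (h : DarbouxInvariant Ω f used d T) (i : ι)
    (hi : IsUnit (T.adj (f i))) :
    DarbouxInvariant Ω f used (d - 1) (T.stepI (f i)) := by
  set F := T.adj (f i) with hF
  set G := Ring.inverse F with hG
  have hFG : F * G = 1 := Ring.mul_inverse_cancel F hi
  obtain ⟨hu, ho, hc⟩ := h.conj_del_mul (-1) ((mul_comm G F).trans hFG)
  obtain ⟨Q, hQ, hdQ⟩ := h.pot_rep i
  have hQ' : Q = del R (-1) * (C F * T.op) := by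
    rw [← hdQ, ← mul_assoc, del_neg_one_mul_del_one, one_mul]
  refine ⟨?_, fun j => ?_, fun φ hφ j => ?_, hu, ho, hc, ?_, ?_⟩
  · -- The new operator is `g⁻¹` times the operator `Q` that represents `Ω(·, g)`, so the
    -- integration constant in `∂⁻¹(g T(φ))` is the one of the potential.
    have := hQ.C_mul G
    rw [hQ', ← mul_assoc, ← mul_assoc] at this
    exact this
  · obtain ⟨P, hP, hdP⟩ := h.pot_rep j
    refine ⟨P - C (T.adj (f j) * G) * Q, hP.sub (hQ.C_mul _), ?_⟩
    have e2 : F * D (T.adj (f j) * G) * G = D (T.adj (f j) * G) := by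
      linear_combination D (T.adj (f j) * G) * hFG
    have e3 : T.adj (f j) * G * F = T.adj (f j) := by
      linear_combination T.adj (f j) * hFG
    change _ = C (-(F * D (T.adj (f j) * G))) * (C G * del R (-1) * C F * T.op)
    rw [mul_sub, hdP, ← mul_assoc, del_one_mul_C, add_mul, mul_assoc _ (del R 1), hdQ, ← mul_assoc,
      ← PDO.C_mul, e3, hQ', C_neg, neg_mul, mul_assoc (C G * del R (-1)), mul_assoc (C G),
      ← mul_assoc _ (C G), ← PDO.C_mul, e2]
    abel
  · change D (T.pot φ (f j) - T.adj (f j) * G * T.pot φ (f i)) =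
      (G * T.pot φ (f i)) * -(F * D (T.adj (f j) * G))
    rw [map_sub, h.deriv_pot φ hφ j, Derivation.leibniz D (T.adj (f j) * G), h.deriv_pot φ hφ i,
      smul_eq_mul, smul_eq_mul]
    linear_combination (D (T.adj (f j) * G) * T.pot φ (f i) - T.app φ * T.adj (f j)) * hFG
  · intro g hg
    change G * T.pot g (f i) = 0
    rw [h.pot_eq_zero g hg, mul_zero]
  · intro g hg ψ
    change T.pot g ψ - T.adj ψ * G * T.pot g (f i) = 0
    rw [h.pot_eq_zero g hg, h.pot_eq_zero g hg, mul_zero, sub_self]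

/-- All transformations `T^{[n,p]}` built from the `f_i` satisfy the invariants. -/
theorem DarbouxInvariant.multi (hf : ∀ i, HasPotentials Ω f (f i)) {fs gs : List R}
    (hfs : ∀ x ∈ fs, ∃ i, f i = x) (hgs : ∀ x ∈ gs, ∃ i, f i = x)
    (hdef : DarbouxData.IsDefined Ω fs gs) :
    DarbouxInvariant Ω f {x | x ∈ fs} (fs.length - gs.length) (DarbouxData.multi Ω fs gs) := by
  have hD : ∀ n ≤ fs.length,
      DarbouxInvariant Ω f {x | x ∈ fs.take n} n (DarbouxData.multi Ω (fs.take n) []) := by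
    intro n
    induction n with
    | zero =>
      intro _
      simpa [DarbouxData.multi] using DarbouxInvariant.init Ω f
    | succ n ih =>
      intro hn
      obtain ⟨i, hi⟩ := hfs fs[n] (List.getElem_mem _)
      have := (ih (by omega)).stepD hf i (hi ▸ hdef.1 n hn)
      convert this using 1
      · ext x
        simp only [List.take_succ_eq_append_getElem hn, Set.mem_ofPred_eq, List.mem_append,
          List.mem_singleton, Set.mem_insert_iff, hi]
        exact or_comm
      · push_cast
        rfl
      · rw [List.take_succ_eq_append_getElem hn, hi, DarbouxData.multi, List.foldl_append]
        rfl
  have hI : ∀ n ≤ gs.length, DarbouxInvariant Ω f {x | x ∈ fs} (fs.length - n)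
      (DarbouxData.multi Ω fs (gs.take n)) := by
    intro n
    induction n with
    | zero =>
      intro _
      simpa [DarbouxData.multi] using hD fs.length le_rfl
    | succ n ih =>
      intro hn
      obtain ⟨i, hi⟩ := hgs gs[n] (List.getElem_mem _)
      have := (ih (by omega)).stepI i (hi ▸ hdef.2 n hn)
      convert this using 1
      · push_cast
        ring
      · rw [List.take_succ_eq_append_getElem hn, hi, DarbouxData.multi, List.foldl_append]
        rfl
  have := hI gs.length le_rfl
  rwa [List.take_length] at this

end Invariants

/-! ### Dressing an operator with a binary Darboux transformation -/

namespace PDO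

section Kernels

attribute [local instance] PDO.ring

variable {R : Type*} [CommRing R] [Differential R]

local notation "D" => (Differential.deriv (R := R))

/-- The operator `a ∂⁻¹ b`. -/
noncomputable def kern (a b : R) : PDO R := C a * del R (-1) * C b

theorem ordLE_kern (a b : R) : (kern a b).OrdLE (-1) := ordLE_mul_del_mul a b

theorem kern_add_left (a a' b : R) : kern (a + a') b = kern a b + kern a' b := by
  simp only [kern, C_add, add_mul]

theorem kern_sub_left (a a' b : R) : kern (a - a') b = kern a b - kern a' b := by
  simp only [kern, C_sub, sub_mul]

theorem kern_sub_right (a b b' : R) : kern a (b - b') = kern a b - kern a b' := by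
  simp only [kern, C_sub, mul_sub]

theorem kern_sum_left {ι : Type*} (s : Finset ι) (a : ι → R) (b : R) :
    kern (∑ i ∈ s, a i) b = ∑ i ∈ s, kern (a i) b := by
  simp only [kern, C_sum, Finset.sum_mul]

theorem kern_sum_right {ι : Type*} (s : Finset ι) (a : R) (b : ι → R) :
    kern a (∑ i ∈ s, b i) = ∑ i ∈ s, kern a (b i) := by
  simp only [kern, C_sum, Finset.mul_sum]

theorem C_zsmul (z : ℤ) (a : R) : C (z • a) = z • C a :=
  map_zsmul (AddMonoidHom.mk' (C : R → PDO R) C_add) z a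

theorem kern_zsmul_left (z : ℤ) (a b : R) : kern (z • a) b = z • kern a b := by
  simp only [kern, C_zsmul, smul_mul_assoc]

theorem kern_zsmul_right (z : ℤ) (a b : R) : kern a (z • b) = z • kern a b := by
  simp only [kern, C_zsmul, mul_smul_comm]

theorem C_mul_kern (c a b : R) : C c * kern a b = kern (c * a) b := by
  simp only [kern, PDO.C_mul, mul_assoc]

theorem OrdLE.sub {A B : PDO R} {N : ℤ} (hA : A.OrdLE N) (hB : B.OrdLE N) : (A - B).OrdLE N :=
  fun n hn => by rw [coeff_sub, hA n hn, hB n hn, sub_zero]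

theorem OrdLE.zsmul {A : PDO R} {N : ℤ} (hA : A.OrdLE N) (z : ℤ) : (z • A).OrdLE N := by
  intro n hn
  have : (z • A).coeff n = z • A.coeff n := map_zsmul (coeffHom n) z A
  rw [this, hA n hn, smul_zero]

/-- The integral part is determined by its order and by its class modulo differential operators. -/
theorem neg_eq_of_isDiff_sub {A N : PDO R} (h : (A - N).IsDiff) (hN : N.OrdLE (-1)) :
    A.neg = N := by
  conv_lhs => rw [← sub_add_cancel A N]
  rw [add_neg_part, h.neg_part, hN.neg_part, zero_add]

end Kernels

end PDO

section Dressing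

open PDO

attribute [local instance] PDO.ring

variable {R : Type*} [CommRing R] [Differential R] {ι : Type*} [Fintype ι]

local notation "D" => (Differential.deriv (R := R))

/-- The function `φ - ∑_j g_j Ω(φ, f_j)`, the action of `1 - ∑_j g_j ∂⁻¹ f_j`. -/
def binaryApp (Ω : R → R → R) (f g : ι → R) (φ : R) : R := φ - ∑ j, g j * Ω φ (f j)

variable {Ω : R → R → R} {f g : ι → R}

/-- If `∑_j g_j Ω(f_i, f_j) = f_i`, then `1 + ∑_j f_j ∂⁻¹ g_j` is a right inverse of
`1 - ∑_j g_j ∂⁻¹ f_j`. -/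
theorem binary_mul_inverse (hf : ∀ i, HasPotentials Ω f (f i)) (hsymm : ∀ a b, Ω a b = Ω b a)
    (hg : ∀ i, ∑ j, g j * Ω (f i) (f j) = f i) :
    (1 - ∑ j, kern (g j) (f j)) * (1 + ∑ i, kern (f i) (g i)) = 1 := by
  have key : (∑ j, kern (g j) (f j)) * (∑ i, kern (f i) (g i)) =
      ∑ i, kern (f i) (g i) - ∑ j, kern (g j) (f j) := by
    have h1 : ∀ j i, kern (g j) (f j) * kern (f i) (g i) =
        kern (g j * Ω (f i) (f j)) (g i) - kern (g j) (g i * Ω (f j) (f i)) := fun j i => by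
      have : D (Ω (f i) (f j)) = f j * f i := (hf i j).trans (mul_comm _ _)
      rw [kern, kern, kernel_mul_kernel this, mul_comm (g i), hsymm (f j)]
      rfl
    rw [Finset.sum_mul_sum]
    simp only [h1, Finset.sum_sub_distrib]
    rw [Finset.sum_comm]
    simp only [← kern_sum_left, ← kern_sum_right, hg]
  rw [sub_mul, one_mul, mul_add, mul_one, key]
  abel

/-- Multiplying `a ∂⁻¹ b` by `1 + ∑_i f_i ∂⁻¹ g_i` on the right. -/
theorem kern_mul_inverse {a b : R} (hb : HasPotentials Ω f b) :
    kern a b * (1 + ∑ i, kern (f i) (g i)) =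
      kern a (binaryApp Ω f g b) + ∑ i, kern (a * Ω b (f i)) (g i) := by
  have h1 : ∀ i, kern a b * kern (f i) (g i) =
      kern (a * Ω b (f i)) (g i) - kern a (g i * Ω b (f i)) := fun i => by
    rw [kern, kern, kernel_mul_kernel (hb i), mul_comm (g i)]
    rfl
  rw [mul_add, mul_one, Finset.mul_sum, binaryApp, kern_sub_right, kern_sum_right]
  simp only [h1, Finset.sum_sub_distrib]
  abel

variable {k m : ℕ} {L : PDO R} {q₁ q₂ : Fin m → R}

theorem constraintForm_eq (k : ℕ) (a b : Fin m → R) :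
    constraintForm k a b = ∑ l, (kern (a l) (b l) - (-1 : ℤ) ^ k • kern (b l) (a l)) := rfl

theorem neg_one_zsmul_neg_one_zsmul {G : Type*} [AddCommGroup G] (k : ℕ) (x : G) :
    (-1 : ℤ) ^ k • (-1 : ℤ) ^ k • x = x := by
  rw [← mul_smul, ← mul_pow, neg_one_mul, neg_neg, one_pow, one_smul]

theorem neg_one_pow_mul {S : Type*} [CommRing S] (k : ℕ) (x : S) :
    (-1) ^ k * x = (-1 : ℤ) ^ k • x := by
  rw [zsmul_eq_mul]
  push_cast
  rfl

/-- The integral part of `∂⁻¹ h L^k`: the normal form on which `invPowApply` is based. -/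
theorem neg_del_mul_pow (hL : L.adjoint = -L) (hc : (L ^ k).neg = constraintForm k q₁ q₂) {h : R}
    (hsymm : ∀ a b, Ω a b = Ω b a)
    (h₁ : ∀ l, D (Ω (q₁ l) h) = q₁ l * h) (h₂ : ∀ l, D (Ω (q₂ l) h) = q₂ l * h) :
    (del R (-1) * C h * L ^ k).neg =
      ∑ l, (kern (Ω h (q₁ l)) (q₂ l) - (-1 : ℤ) ^ k • kern (Ω h (q₂ l)) (q₁ l))
        + (-1 : ℤ) ^ k • kern 1 (powApply Ω L k q₁ q₂ h) := by
  have hone : ∀ b : R, kern 1 b = del R (-1) * C b := fun b => by rw [kern, C_one, one_mul]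
  have hk : ∀ {q : R}, D (Ω q h) = q * h → ∀ q', del R (-1) * C h * kern q q' =
      kern (Ω h q) q' - kern 1 (Ω q h * q') := fun {q} hq q' => by
    have := kernel_mul_kernel (hq.trans (mul_comm _ _)) 1 q'
    rw [C_one, one_mul, one_mul] at this
    rw [hone, hsymm h q]
    exact this
  have hE : (C h * (L ^ k).nonneg).adjoint.coeff 0 = (-1 : ℤ) ^ k • (L ^ k).applyNonneg h := by
    rw [adjoint_C_mul, ← applyNonneg_eq_coeff, adjoint_nonneg_part, nonneg_applyNonneg,
      adjoint_pow_of_eq_neg hL, applyNonneg_eq_coeff, applyNonneg_eq_coeff, smul_mul_assoc]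
    exact map_zsmul (coeffHom 0) _ _
  have hdiff := ((isDiff_C h).mul (isDiff_nonneg (L ^ k))).del_neg_one_mul
  rw [hE, ← hone, kern_zsmul_right] at hdiff
  refine neg_eq_of_isDiff_sub ?_ ((OrdLE.sum fun l _ => (ordLE_kern _ _).sub
    ((ordLE_kern _ _).zsmul _)).add ((ordLE_kern _ _).zsmul _))
  convert hdiff using 1
  have hA : del R (-1) * C h * L ^ k = del R (-1) * (C h * (L ^ k).nonneg)
      + ∑ l, (del R (-1) * C h * kern (q₁ l) (q₂ l)
        - (-1 : ℤ) ^ k • (del R (-1) * C h * kern (q₂ l) (q₁ l))) := by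
    conv_lhs => rw [← nonneg_add_neg (L ^ k), hc, constraintForm_eq]
    rw [mul_add, mul_assoc _ _ (L ^ k).nonneg, Finset.mul_sum]
    simp only [mul_sub, mul_smul_comm]
  have hp : kern 1 (powApply Ω L k q₁ q₂ h) = kern 1 ((L ^ k).applyNonneg h) +
      ∑ l, (kern 1 (Ω (q₂ l) h * q₁ l) - (-1 : ℤ) ^ k • kern 1 (Ω (q₁ l) h * q₂ l)) := by
    simp only [hone, powApply, C_add, C_sum, C_sub, neg_one_pow_mul, C_zsmul, mul_add,
      Finset.mul_sum, mul_sub, mul_smul_comm, mul_comm (q₁ _), mul_comm (q₂ _)]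
  rw [hA, hp, smul_add, Finset.smul_sum]
  simp only [hk (h₁ _), hk (h₂ _), smul_sub, neg_one_zsmul_neg_one_zsmul, Finset.sum_sub_distrib]
  abel

/-- The integral part of `T L^k T⁻¹` for `T = 1 - ∑_j g_j ∂⁻¹ f_j` and
`T⁻¹ = 1 + ∑_j f_j ∂⁻¹ g_j`. The consistent choice of integration constants is what turns the
coefficient of `∂⁻¹ g_i` into `T(L^k(f_i))`. -/
theorem neg_dressing (hL : L.adjoint = -L) (hc : (L ^ k).neg = constraintForm k q₁ q₂)
    (hsymm : ∀ a b, Ω a b = Ω b a)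
    (h₁ : ∀ l, HasPotentials Ω f (q₁ l)) (h₂ : ∀ l, HasPotentials Ω f (q₂ l))
    (hp : ∀ j, HasPotentials Ω f (powApply Ω L k q₁ q₂ (f j)))
    (hconst : ∀ i j, Ω (f i) (powApply Ω L k q₁ q₂ (f j)) =
      invPowApply Ω L k q₁ q₂ (f i) (f j)) :
    ((1 - ∑ j, kern (g j) (f j)) * L ^ k * (1 + ∑ i, kern (f i) (g i))).neg =
      ∑ j, kern (binaryApp Ω f g (powApply Ω L k q₁ q₂ (f j))) (g j)
      - (-1 : ℤ) ^ k • ∑ j, kern (g j) (binaryApp Ω f g (powApply Ω L k q₁ q₂ (f j)))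
      + ∑ l, (kern (binaryApp Ω f g (q₁ l)) (binaryApp Ω f g (q₂ l))
          - (-1 : ℤ) ^ k • kern (binaryApp Ω f g (q₂ l)) (binaryApp Ω f g (q₁ l))) := by
  set A := L ^ k with hA
  set p : ι → R := fun j => powApply Ω L k q₁ q₂ (f j) with hpdef
  set ε : ℤ := (-1 : ℤ) ^ k with hε
  set T' : PDO R := 1 + ∑ i, kern (f i) (g i) with hT'
  -- `E` is the differential part of `T L^k`.
  let Q : ι → PDO R := fun j => (del R (-1) * C (f j) * A).nonneg
  let E : PDO R := A.nonneg - ∑ j, C (g j) * Q j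
  have hEdiff : E.IsDiff := (isDiff_nonneg _).sub
    (IsDiff.sum fun j _ => (isDiff_C _).mul (isDiff_nonneg _))
  have hkernA : ∀ j, kern (g j) (f j) * A = C (g j) * Q j
      + ∑ l, (kern (g j * Ω (q₁ l) (f j)) (q₂ l) - ε • kern (g j * Ω (q₂ l) (f j)) (q₁ l))
      + ε • kern (g j) (p j) := fun j => by
    have h := neg_del_mul_pow (Ω := Ω) hL hc hsymm (fun l => h₁ l j) (fun l => h₂ l j)
    have h' : kern (g j) (f j) * A = C (g j) * (Q j + (del R (-1) * C (f j) * A).neg) := by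
      rw [nonneg_add_neg, kern]
      simp only [mul_assoc]
    rw [h', h, mul_add, mul_add, Finset.mul_sum, add_assoc]
    simp only [mul_sub, mul_smul_comm, C_mul_kern, mul_one, hsymm (f j) (q₁ _),
      hsymm (f j) (q₂ _)]
    rfl
  have hTA : (1 - ∑ j, kern (g j) (f j)) * A = E
      + ∑ l, (kern (binaryApp Ω f g (q₁ l)) (q₂ l) - ε • kern (binaryApp Ω f g (q₂ l)) (q₁ l))
      - ε • ∑ j, kern (g j) (p j) := by
    have hA' : A = A.nonneg + ∑ l, (kern (q₁ l) (q₂ l) - ε • kern (q₂ l) (q₁ l)) := by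
      conv_lhs => rw [← nonneg_add_neg A, hc, constraintForm_eq]
    rw [Finset.sum_sub_distrib] at hA'
    refine sub_eq_zero.1 (Eq.trans ?_ (sub_eq_zero.2 hA'))
    rw [sub_mul, one_mul, Finset.sum_mul]
    simp only [hkernA, E, binaryApp, kern_sub_left, kern_sum_left, Finset.sum_add_distrib,
      Finset.sum_sub_distrib, smul_sub, Finset.smul_sum]
    rw [Finset.sum_comm, Finset.sum_comm (f := fun j l => ε • kern (g j * Ω (q₂ l) (f j)) (q₁ l))]
    abel
  -- The coefficient of `∂⁻¹ g_i` in the product.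
  have hcoeff : ∀ i, E.applyNonneg (f i)
      + ∑ l, (binaryApp Ω f g (q₁ l) * Ω (q₂ l) (f i)
        - ε • (binaryApp Ω f g (q₂ l) * Ω (q₁ l) (f i)))
      - ε • ∑ j, g j * Ω (p j) (f i) = binaryApp Ω f g (p i) := fun i => by
    have hQ : ∀ j, (Q j).applyNonneg (f i) =
        (del R (-1) * C (f j) * A * C (f i) * del R (-1)).res := fun j => by
      rw [nonneg_applyNonneg, applyNonneg_eq_coeff, res, coeff_mul_del]
      rfl
    have hE : E.applyNonneg (f i) = A.applyNonneg (f i) - ∑ j, g j * (Q j).applyNonneg (f i) := by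
      simp only [E, sub_applyNonneg, nonneg_applyNonneg, sum_applyNonneg, C_mul_applyNonneg]
    have hΩ : ∀ j, Ω (p i) (f j) = (Q j).applyNonneg (f i)
        + ∑ l, (Ω (q₁ l) (f j) * Ω (q₂ l) (f i) - ε • (Ω (q₂ l) (f j) * Ω (q₁ l) (f i)))
        + ε • Ω (p j) (f i) := fun j => by
      rw [hsymm, hpdef]
      simp only
      rw [hconst, invPowApply, hQ j]
      simp only [neg_one_pow_mul, hsymm (f j) (q₁ _), hsymm (f j) (q₂ _)]
      rfl
    have hpi : p i = A.applyNonneg (f i)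
        + ∑ l, (q₁ l * Ω (q₂ l) (f i) - ε • (q₂ l * Ω (q₁ l) (f i))) := by
      simp only [hpdef, powApply, neg_one_pow_mul]
      rfl
    rw [Finset.sum_sub_distrib] at hpi
    refine sub_eq_zero.1 (Eq.trans ?_ (sub_eq_zero.2 hpi.symm))
    rw [hE]
    simp only [hΩ, binaryApp, sub_mul, Finset.sum_mul, mul_add, mul_sub, Finset.mul_sum,
      mul_smul_comm, Finset.sum_add_distrib, Finset.sum_sub_distrib, smul_sub, Finset.smul_sum,
      mul_assoc]
    rw [Finset.sum_comm, Finset.sum_comm (f := fun l j => ε • (g j * (Ω (q₂ l) (f j) * _)))]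
    abel
  have hleft : ∑ i, kern (binaryApp Ω f g (p i)) (g i) =
      ∑ i, kern (E.applyNonneg (f i)) (g i)
        + (∑ l, ∑ i, kern (binaryApp Ω f g (q₁ l) * Ω (q₂ l) (f i)) (g i)
          - ∑ l, ∑ i, ε • kern (binaryApp Ω f g (q₂ l) * Ω (q₁ l) (f i)) (g i))
        - ∑ j, ∑ i, ε • kern (g j * Ω (p j) (f i)) (g i) := by
    simp only [← hcoeff, kern_add_left, kern_sub_left, kern_sum_left, kern_zsmul_left,
      Finset.sum_add_distrib, Finset.sum_sub_distrib, Finset.smul_sum]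
    congr 1
    · congr 1
      congr 1 <;> exact Finset.sum_comm
    · exact Finset.sum_comm
  have hp' : ∀ j, HasPotentials Ω f (p j) := hp
  have hTAT : (1 - ∑ j, kern (g j) (f j)) * A * T' = E
      + ∑ i, (E * kern (f i) (g i) - kern (E.applyNonneg (f i)) (g i))
      + (∑ i, kern (binaryApp Ω f g (p i)) (g i)
        - ε • ∑ j, kern (g j) (binaryApp Ω f g (p j))
        + ∑ l, (kern (binaryApp Ω f g (q₁ l)) (binaryApp Ω f g (q₂ l))
          - ε • kern (binaryApp Ω f g (q₂ l)) (binaryApp Ω f g (q₁ l)))) := by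
    have hET : E * T' = E + ∑ i, E * kern (f i) (g i) := by
      rw [hT', mul_add, mul_one, Finset.mul_sum]
    rw [hTA, sub_mul, add_mul, hET, Finset.sum_mul, smul_mul_assoc, Finset.sum_mul, hleft]
    simp only [sub_mul, smul_mul_assoc, hT', kern_mul_inverse (h₁ _), kern_mul_inverse (h₂ _),
      kern_mul_inverse (hp' _)]
    simp only [Finset.sum_add_distrib, Finset.sum_sub_distrib, smul_add, Finset.smul_sum]
    abel
  rw [hTAT]
  refine neg_eq_of_isDiff_sub ?_ ?_
  · rw [add_sub_cancel_right]
    exact hEdiff.add (IsDiff.sum fun i _ => hEdiff.mul_kernel _ _)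
  · exact ((OrdLE.sum fun _ _ => ordLE_kern _ _).sub
      ((OrdLE.sum fun _ _ => ordLE_kern _ _).zsmul _)).add
        (OrdLE.sum fun _ _ => (ordLE_kern _ _).sub ((ordLE_kern _ _).zsmul _))

end Dressing

/-! ### The transformed constrained CKP hierarchy -/

section Potentials

open PDO

attribute [local instance] PDO.ring

variable {R : Type*} [CommRing R] [Differential R]

/-- The defining equation of a squared eigenfunction potential for `t₁ = x` reads `ω_x = f g`. -/
theorem IsSEP.deriv_eq {t : OddTimes R} {L : PDO R} (hL : L.OrdLE 1) (hL1 : L.coeff 1 = 1)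
    {f g ω : R} (h : IsSEP t L f g ω) : Differential.deriv ω = f * g := by
  have h1 := h 1 odd_one
  have o1 := (ordLE_del (R := R) (-1)).mul (ordLE_C g)
  have o2 := o1.mul hL
  have o3 := o2.mul (ordLE_C f)
  have hc := coeff_mul_top o3 (ordLE_del (R := R) (-1))
  rw [coeff_mul_top o2 (ordLE_C f), coeff_mul_top o1 hL,
    coeff_mul_top (ordLE_del (-1)) (ordLE_C g), coeff_C, coeff_C, coeff_del, hL1] at hc
  rw [t.d_one, pow_one, res] at h1
  rw [h1]
  refine Eq.trans hc ?_
  simp [mul_comm]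

end Potentials

section Darboux

open PDO

attribute [local instance] PDO.ring

variable {R : Type*} [CommRing R] [Differential R] {M : ℕ} {Ω : R → R → R} {f : Fin M → R}

/-- The transformation `T^{M}` is the binary Darboux operator `1 - ∑_j g_j ∂⁻¹ f_j`, where `g`
solves `∑_j Ω(f_i, f_j) g_j = f_i` because `T^{M}` annihilates the `f_i`. -/
theorem exists_ckp_eq (hf : ∀ i, HasPotentials Ω f (f i)) (hsymm : ∀ a b, Ω a b = Ω b a)
    (hT : DarbouxData.IsDefined Ω (List.ofFn f) (List.ofFn f)) :
    ∃ g : Fin M → R, (∀ i, ∑ j, g j * Ω (f i) (f j) = f i) ∧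
      (DarbouxData.ckp Ω f).op = 1 - ∑ j, kern (g j) (f j) ∧
      (DarbouxData.ckp Ω f).op * (1 + ∑ i, kern (f i) (g i)) = 1 ∧
      (1 + ∑ i, kern (f i) (g i)) * (DarbouxData.ckp Ω f).op = 1 ∧
      ∀ φ, HasPotentials Ω f φ → (DarbouxData.ckp Ω f).app φ = binaryApp Ω f g φ := by
  have hmem : ∀ x ∈ List.ofFn f, ∃ i, f i = x := fun x hx => by simpa [List.mem_ofFn] using hx
  have h := DarbouxInvariant.multi hf hmem hmem hT
  rw [sub_self] at h
  obtain ⟨β, hop, happ⟩ := h.app_rep.exists_of_isDiff_sub isDiff_one (fun n hn => by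
    rw [coeff_sub, coeff_one]
    split_ifs with h0
    · rw [h0, h.coeff_top, sub_self]
    · rw [h.ordLE n (by omega), sub_zero])
  have happ' : ∀ φ, HasPotentials Ω f φ →
      (DarbouxData.ckp Ω f).app φ = binaryApp Ω f (fun j => -β j) φ := fun φ hφ => by
    rw [binaryApp]
    simp only [neg_mul, Finset.sum_neg_distrib, sub_neg_eq_add]
    exact (happ φ hφ).trans (by rw [one_applyNonneg])
  have hg : ∀ i, ∑ j, -β j * Ω (f i) (f j) = f i := fun i => by
    have h0 : (DarbouxData.ckp Ω f).app (f i) = 0 :=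
      h.app_eq_zero (f i) (List.mem_ofFn.2 ⟨i, rfl⟩)
    rw [happ' _ (hf i), binaryApp, sub_eq_zero] at h0
    exact h0.symm
  have hop' : (DarbouxData.ckp Ω f).op = 1 - ∑ j, kern (-β j) (f j) := by
    simp only [kern, C_neg, neg_mul, Finset.sum_neg_distrib, sub_neg_eq_add]
    exact hop
  have hright : (DarbouxData.ckp Ω f).op * (1 + ∑ i, kern (f i) (-β i)) = 1 := by
    rw [hop']
    exact binary_mul_inverse hf hsymm hg
  refine ⟨fun j => -β j, hg, hop', hright, IsUnit.mul_left_cancel h.isUnit ?_, happ'⟩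
  exact (mul_assoc _ _ _).symm.trans ((congrArg (· * _) hright).trans
    ((one_mul _).trans (mul_one _).symm))

/-- `T^{[M∖{j},M]}` is a monic operator `∑_l σ_l ∂⁻¹ f_l` of order `-1` which annihilates the `f_i`,
`i ≠ j`. Pairing `∑_l σ_l Ω(f_i, f_l) = δ_{ij} h_j` with `g` gives `h_j g_j = ∑_l σ_l f_l = 1`. -/
theorem ckpDrop_app_mul (hf : ∀ i, HasPotentials Ω f (f i)) (hsymm : ∀ a b, Ω a b = Ω b a)
    {g : Fin M → R} (hg : ∀ i, ∑ j, g j * Ω (f i) (f j) = f i) (j : Fin M)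
    (hTj : DarbouxData.IsDefined Ω ((List.ofFn f).eraseIdx j) (List.ofFn f)) :
    (DarbouxData.ckpDrop Ω f j).app (f j) * g j = 1 := by
  have hmem : ∀ x ∈ List.ofFn f, ∃ i, f i = x := fun x hx => by simpa [List.mem_ofFn] using hx
  have h := DarbouxInvariant.multi hf (fun x hx => hmem x (List.mem_of_mem_eraseIdx hx)) hmem hTj
  have hd : (((List.ofFn f).eraseIdx j).length : ℤ) - (List.ofFn f).length = -1 := by
    have hj := j.2
    rw [List.length_eraseIdx, List.length_ofFn, if_pos hj]
    omega
  rw [hd] at h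
  obtain ⟨σ, hop, happ⟩ := h.app_rep.exists_of_isDiff_sub isDiff_zero (by simpa using h.ordLE)
  have hσ : ∑ l, σ l * f l = 1 := by
    have h1 := h.coeff_top
    rw [hop, zero_add, coeff_sum] at h1
    rw [← h1]
    refine Finset.sum_congr rfl fun l _ => ?_
    rw [mul_assoc, coeff_C_mul]
    have := coeff_mul_top (ordLE_del (R := R) (-1)) (ordLE_C (f l))
    rw [add_zero, coeff_del, coeff_C, if_pos rfl, if_pos rfl, one_mul] at this
    rw [this]
  have happ' : ∀ i, (DarbouxData.ckpDrop Ω f j).app (f i) = ∑ l, σ l * Ω (f i) (f l) := fun i => by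
    refine (happ _ (hf i)).trans ?_
    rw [applyNonneg_eq_coeff, zero_mul, PDO.coeff_zero, zero_add]
  have hzero : ∀ i, i ≠ j → (DarbouxData.ckpDrop Ω f j).app (f i) = 0 := fun i hi => by
    refine h.app_eq_zero (f i) ?_
    change f i ∈ (List.ofFn f).eraseIdx j
    rw [List.mem_eraseIdx_iff_getElem]
    exact ⟨i, by simp, fun h => hi (Fin.ext h), by simp⟩
  calc (DarbouxData.ckpDrop Ω f j).app (f j) * g j
      = ∑ i, (DarbouxData.ckpDrop Ω f j).app (f i) * g i := by
        rw [Finset.sum_eq_single j]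
        · intro i _ hi
          rw [hzero i hi, zero_mul]
        · simp
    _ = ∑ l, σ l * ∑ i, g i * Ω (f l) (f i) := by
        simp only [happ', Finset.sum_mul, Finset.mul_sum]
        rw [Finset.sum_comm]
        refine Finset.sum_congr rfl fun l _ => Finset.sum_congr rfl fun i _ => ?_
        rw [hsymm (f l)]
        ring
    _ = 1 := by simp only [hg, hσ]

end Darboux

theorem mainTheorem2 {R : Type*} [CommRing R] [Algebra ℚ R] [Differential R] (t : OddTimes R)
    {k m M : ℕ} (hk : 0 < k)
    (L : PDO R) (q₁ q₂ : Fin m → R) (hL : IsConstrainedCKP t k m L q₁ q₂)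
    (f : Fin M → R) (hf : ∀ j, IsEigenfunction t L (f j))
    -- the chosen squared eigenfunction potentials
    (Ω : R → R → R) (hΩ_symm : ∀ a b, Ω a b = Ω b a)
    (hΩ_f : ∀ i j, IsSEP t L (f i) (f j) (Ω (f i) (f j)))
    (hΩ_q₁ : ∀ i j, IsSEP t L (q₁ i) (f j) (Ω (q₁ i) (f j)))
    (hΩ_q₂ : ∀ i j, IsSEP t L (q₂ i) (f j) (Ω (q₂ i) (f j)))
    (hΩ_L : ∀ i j, IsSEP t L (f i) (powApply Ω L k q₁ q₂ (f j))
      (Ω (f i) (powApply Ω L k q₁ q₂ (f j))))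
    -- integration constants are chosen consistently: `∂⁻¹(f_i L^k(f_j)) = (∂⁻¹ f_i L^k)(f_j)`
    (hΩ_const : ∀ i j, Ω (f i) (powApply Ω L k q₁ q₂ (f j)) =
      invPowApply Ω L k q₁ q₂ (f i) (f j))
    -- the Darboux transformations in the formula are defined
    (hT : DarbouxData.IsDefined Ω (List.ofFn f) (List.ofFn f))
    (hTj : ∀ j : Fin M, DarbouxData.IsDefined Ω ((List.ofFn f).eraseIdx j) (List.ofFn f)) :
    (∀ j, IsUnit ((DarbouxData.ckpDrop Ω f j).app (f j))) ∧
    ∃ Tinv : PDO R,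
      (DarbouxData.ckp Ω f).op * Tinv = 1 ∧ Tinv * (DarbouxData.ckp Ω f).op = 1 ∧
      ((DarbouxData.ckp Ω f).op * L ^ k * Tinv).neg =
        ∑ j, PDO.C ((DarbouxData.ckp Ω f).app (powApply Ω L k q₁ q₂ (f j))) * PDO.del R (-1) *
            PDO.C (Ring.inverse ((DarbouxData.ckpDrop Ω f j).app (f j)))
        - (-1 : ℤ) ^ k • ∑ j, PDO.C (Ring.inverse ((DarbouxData.ckpDrop Ω f j).app (f j))) *
            PDO.del R (-1) * PDO.C ((DarbouxData.ckp Ω f).app (powApply Ω L k q₁ q₂ (f j)))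
        + ∑ i, (PDO.C ((DarbouxData.ckp Ω f).app (q₁ i)) * PDO.del R (-1) *
              PDO.C ((DarbouxData.ckp Ω f).app (q₂ i))
            - (-1 : ℤ) ^ k • (PDO.C ((DarbouxData.ckp Ω f).app (q₂ i)) * PDO.del R (-1) *
              PDO.C ((DarbouxData.ckp Ω f).app (q₁ i)))) := by
  have hord : L.OrdLE 1 := hL.coeff_of_one_lt
  have hfp : ∀ i, HasPotentials Ω f (f i) := fun i j => (hΩ_f i j).deriv_eq hord hL.coeff_one
  have h₁ : ∀ i, HasPotentials Ω f (q₁ i) := fun i j => (hΩ_q₁ i j).deriv_eq hord hL.coeff_one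
  have h₂ : ∀ i, HasPotentials Ω f (q₂ i) := fun i j => (hΩ_q₂ i j).deriv_eq hord hL.coeff_one
  have hp : ∀ j, HasPotentials Ω f (powApply Ω L k q₁ q₂ (f j)) := fun j i => by
    rw [hΩ_symm, (hΩ_L i j).deriv_eq hord hL.coeff_one, mul_comm]
  obtain ⟨g, hg, hop, hright, hleft, happ⟩ := exists_ckp_eq hfp hΩ_symm hT
  have hdrop : ∀ j, (DarbouxData.ckpDrop Ω f j).app (f j) * g j = 1 := fun j =>
    ckpDrop_app_mul hfp hΩ_symm hg j (hTj j)
  have hdropUnit : ∀ j, IsUnit ((DarbouxData.ckpDrop Ω f j).app (f j)) := fun j =>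
    IsUnit.of_mul_eq_one _ (hdrop j)
  have hinv : ∀ j, Ring.inverse ((DarbouxData.ckpDrop Ω f j).app (f j)) = g j := fun j =>
    left_inv_eq_right_inv (Ring.inverse_mul_cancel _ (hdropUnit j)) (hdrop j)
  refine ⟨hdropUnit, _, hright, hleft, ?_⟩
  simp only [hinv, happ _ (hp _), happ _ (h₁ _), happ _ (h₂ _), hop]
  exact neg_dressing hL.adjoint_eq hL.constraint hΩ_symm h₁ h₂ hp hΩ_const
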